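/- Let $p>3$ be a prime with $p\neq 11$. A \emph{$3$-januarial} on a finite set $S$ is given by permutations $x,y$ of $S$ with $x^2=y^3=1$ such that $\langle x,y\rangle$ is transitive on $S$ and $\langle xy\rangle$ has exactly two orbits on $S$, each of size $|S|/2$ (products are read from left to right). It is the cell decomposition of a closed oriented surface obtained from the coset graph of $(x,y)$ (with vertex set $S$, an unoriented $x$-edge between $s$ and $s^x$, and an oriented $y$-edge from $s$ to $s^y$) by attaching a monogon at each fixed point of $x$, a polygon along each orbit of $\langle y\rangle$, and a polygon along each of the two orbits of $\langle xy\rangle$. Two $3$-januarials are isomorphic if some bijection of their vertex sets carries $x$-edges to $x$-edges and oriented $y$-edges to oriented $y$-edges; they are isomorphic up to reflection if such a bijection exists that preserves the $x$-edges and either preserves the orientation of all $y$-edges or reverses the orientation of all $y$-edges. Let $\mathrm{PSL}(2,p)\le \mathrm{PGL}(2,p)$ act on $S=\mathbb F_p\cup\{\infty\}$ by M\"obius transformations. Consider the $3$-januarials on $S$ that arise from $\mathrm{PSL}(2,p)$ as associates, that is, those given by pairs $(x',y)$ with $x',y\in \mathrm{PSL}(2,p)$ for which there are $x,t\in\mathrm{PGL}(2,p)$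 such that $x^2=1$, $t$ has order $2$, $t^{-1}xt=x^{-1}$, $t^{-1}yt=y^{-1}$ and $x'=xt$. Then the number of isomorphism classes of these $3$-januarials is $$\tfrac12\,\phi\!\left(\tfrac{p+1}{2}\right),$$ where $\phi$ is Euler's totient function. The number of their classes up to isomorphism and reflection is the same. -/

import Mathlib

/-- A `k`-januarial with vertex set `S`, given by the action on the finite set `S` of the generators
`x`, `y` of a triangle group `Δ(2,k,l) = ⟨x, y ∣ x² = yᵏ = (xy)ˡ = 1⟩` from which it is built.
The action is transitive, i.e. the coset graph (an `x`-edge joining `s` to `x s` and a `y`-edge from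
`s` to `y s`, for every `s`) is connected. The `2`-complex has one `x`-monogon for each fixed point
of `x`, one `y`-face for each orbit of `⟨y⟩` and one `xy`-face for each orbit of `⟨xy⟩`. It is a
januarial if there are exactly two `xy`-faces and both orbits of `⟨xy⟩` have size `|S|/2`.
Words are read from left to right (first `x`, then `y`), so that `xy` is the permutation `y * x`;
the number `l` may be any multiple of the order of `y * x`. -/
structure Januarial (k : ℕ) (S : Type*) where
  finite : Finite S
  x : Equiv.Perm S
  y : Equiv.Perm S
  x_sq : x ^ 2 = 1
  y_pow : y ^ k = 1
  transitive : ∀ s s' : S, ∃ g ∈ Subgroup.closure ({x, y} : Set (Equiv.Perm S)), g s = s'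
  two_faces : Nat.card (MulAction.orbitRel.Quotient (Subgroup.zpowers (y * x)) S) = 2
  face_size : ∀ s : S, 2 * (MulAction.orbit (Subgroup.zpowers (y * x)) s).ncard = Nat.card S

namespace Januarial

variable {k : ℕ} {S : Type*}

/-- Two januarials are isomorphic if a bijection of the vertices carries `x`-edges to `x`-edges and
(oriented) `y`-edges to `y`-edges; it then carries `x`-monogons, `y`-faces and `xy`-faces to faces
of the same kind. -/
def Iso (J J' : Januarial k S) : Prop :=
  ∃ e : Equiv.Perm S, (∀ s, e (J.x s) = J'.x (e s)) ∧ (∀ s, e (J.y s) = J'.y (e s))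

/-- Isomorphism up to reflection: the bijection of the vertices is allowed to reverse the
orientation of the surface, and thus the direction of all `y`-edges. -/
def IsoOrMirror (J J' : Januarial k S) : Prop :=
  ∃ e : Equiv.Perm S, (∀ s, e (J.x s) = J'.x (e s)) ∧
    ((∀ s, e (J.y s) = J'.y (e s)) ∨ (∀ s, e (J.y s) = J'.y⁻¹ (e s)))

theorem Iso.equivalence : Equivalence (Iso (k := k) (S := S)) where
  refl J := ⟨1, fun _ => rfl, fun _ => rfl⟩
  symm := by
    rintro J J' ⟨e, hx, hy⟩
    refine ⟨e.symm, fun s => ?_, fun s => ?_⟩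
    · rw [Equiv.symm_apply_eq, hx, Equiv.apply_symm_apply]
    · rw [Equiv.symm_apply_eq, hy, Equiv.apply_symm_apply]
  trans := by
    rintro J J' J'' ⟨e, hx, hy⟩ ⟨f, fx, fy⟩
    exact ⟨e.trans f, fun s => by simp [hx, fx], fun s => by simp [hy, fy]⟩

theorem inv_conj {y y' e : Equiv.Perm S} (h : ∀ s, e (y s) = y' (e s)) (s : S) :
    e (y⁻¹ s) = y'⁻¹ (e s) := by
  rw [Equiv.Perm.eq_inv_iff_eq, ← h]; simp

theorem IsoOrMirror.equivalence : Equivalence (IsoOrMirror (k := k) (S := S)) where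
  refl J := ⟨1, fun _ => rfl, Or.inl fun _ => rfl⟩
  symm := by
    rintro J J' ⟨e, hx, hy⟩
    refine ⟨e.symm, fun s => ?_, ?_⟩
    · rw [Equiv.symm_apply_eq, hx, Equiv.apply_symm_apply]
    · rcases hy with hy | hy
      · refine Or.inl fun s => ?_
        rw [Equiv.symm_apply_eq, hy, Equiv.apply_symm_apply]
      · refine Or.inr fun s => ?_
        rw [Equiv.symm_apply_eq, inv_conj hy, inv_inv, Equiv.apply_symm_apply]
  trans := by
    rintro J J' J'' ⟨e, hx, hy⟩ ⟨f, fx, fy⟩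
    refine ⟨e.trans f, fun s => by simp [hx, fx], ?_⟩
    rcases hy with hy | hy <;> rcases fy with fy | fy
    · exact Or.inl fun s => by simp [hy, fy]
    · exact Or.inr fun s => by
        rw [Equiv.trans_apply, Equiv.trans_apply, hy, fy]
    · exact Or.inr fun s => by
        rw [Equiv.trans_apply, Equiv.trans_apply, hy, inv_conj fy]
    · exact Or.inl fun s => by
        rw [Equiv.trans_apply, Equiv.trans_apply, hy, inv_conj fy, inv_inv]

/-- The setoid of isomorphism on a set `A` of januarials. -/
def isoSetoid (A : Set (Januarial k S)) : Setoid A :=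
  Setoid.comap Subtype.val ⟨Iso, Iso.equivalence⟩

/-- The setoid of isomorphism up to reflection on a set `A` of januarials. -/
def isoOrMirrorSetoid (A : Set (Januarial k S)) : Setoid A :=
  Setoid.comap Subtype.val ⟨IsoOrMirror, IsoOrMirror.equivalence⟩

end Januarial

section Moebius

variable (K : Type*) [Field K] [DecidableEq K]

/-- `PGL(2,K)`, as the group of all Möbius transformations of the projective line `K ∪ {∞}`. -/
def moebiusPGL : Subgroup (Equiv.Perm (OnePoint K)) :=
  (MulAction.toPermHom (Matrix.GeneralLinearGroup (Fin 2) K) (OnePoint K)).range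

/-- `PSL(2,K)`, as the group of the Möbius transformations of `K ∪ {∞}` that are induced by matrices
of determinant one. -/
def moebiusPSL : Subgroup (Equiv.Perm (OnePoint K)) :=
  ((MulAction.toPermHom (Matrix.GeneralLinearGroup (Fin 2) K) (OnePoint K)).comp
    Matrix.SpecialLinearGroup.toGL).range

end Moebius

/-- The pair `(x', y)` is the associate of the pair `(x, y)` by means of `t`: the element `t` has
order two, it inverts both `x` and `y` by conjugation, and `x' = xt` (first `x`, then `t`). -/
structure IsAssociate {S : Type*} (x y t x' : Equiv.Perm S) : Prop where
  order_t : orderOf t = 2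
  conj_x : t⁻¹ * x * t = x⁻¹
  conj_y : t⁻¹ * y * t = y⁻¹
  eq : x' = t * x

/-- The `3`-januarials on the projective line `F_p ∪ {∞}` that are constructible from `PSL(2,p)` as
associates: both generators `x'`, `y` of the action lie in `PSL(2,p)`, and `(x', y)` is the
associate, by means of an involution `t` of `PGL(2,p)`, of a pair `(x, y)` with `x ∈ PGL(2,p)`,
`x² = 1` (and `y³ = 1`, as part of the definition of a `3`-januarial). -/
def associateJanuarials (p : ℕ) [Fact p.Prime] : Set (Januarial 3 (OnePoint (ZMod p))) :=
  {J | J.x ∈ moebiusPSL (ZMod p) ∧ J.y ∈ moebiusPSL (ZMod p) ∧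
    ∃ x ∈ moebiusPGL (ZMod p), ∃ t ∈ moebiusPGL (ZMod p),
      x ^ 2 = 1 ∧ IsAssociate x J.y t J.x}

/-! Put n = (p+1)/2 and let L be the field with p² elements. The generators of such a januarial lift
to matrices X, Y of determinant 1 with tr X = 0 and tr Y = 1. Only the sign of X stays free, so
tr(YX)² is well defined. All orbits of YX on the projective line over F_p have n points, which means
that YX has an eigenvalue ζ in L whose square w is a primitive n-th root of unity. Hence tr(YX)² = w
+ w⁻¹ + 2, and since w and w⁻¹ give the same value there are φ(n)/2 values. It remains to see that
tr(YX)² is a complete invariant and that every value occurs.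

Equal values give isomorphic januarials: the traces determine (X, Y) up to conjugation
(`exists_conj_of_trace_eq`) unless tr(YX)² = 3, which would force n = 6, that is p = 11.

Isomorphic januarials have equal values: an isomorphism is a mere bijection of the vertices, but for
n ≥ 7 the group ⟨X, Y⟩ contains a parabolic element (`exists_isParabolic`), and a bijection that
conjugates it into PSL(2,p) is itself a Möbius transformation (`mem_moebiusPGL_of_conj_parabolic`).
For smaller n there is only one value.

Every value occurs (`exists_associateJanuarial`): X is a quarter turn, Y comes from a representation
of (r² − 3)/4 as a sum of two squares, where r = tr(YX), and an explicit reflection inverts both.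
Transitivity, like the existence of parabolic elements, follows from Burnside-type counts on the
projective line over L, with no classification of the subgroups of PSL(2,p).

Finally, the involution t of an associate carries the januarial to its mirror image, so reflections
merge no classes. -/

open Matrix MulAction

/-- The action of `GL(2,K)` on the projective line by Möbius transformations. -/
abbrev moebiusHom (K : Type*) [Field K] [DecidableEq K] : GL (Fin 2) K →* Equiv.Perm (OnePoint K) :=
  MulAction.toPermHom (GL (Fin 2) K) (OnePoint K)

/-! ### Möbius transformations and their fixed points -/

section MoebiusBasics

variable {K : Type*} [Field K] [DecidableEq K]

theorem mem_moebiusPSL_iff {g : Equiv.Perm (OnePoint K)} :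
    g ∈ moebiusPSL K ↔ ∃ A : GL (Fin 2) K, A.val.det = 1 ∧ moebiusHom K A = g := by
  constructor
  · rintro ⟨A, rfl⟩
    exact ⟨SpecialLinearGroup.toGL A, A.2, rfl⟩
  · rintro ⟨A, hA, rfl⟩
    let B : SpecialLinearGroup (Fin 2) K := ⟨A.val, hA⟩
    have hB : SpecialLinearGroup.toGL B = A := Units.ext rfl
    exact ⟨B, by rw [MonoidHom.comp_apply, hB]⟩

theorem smul_coe_eq_self_iff {A : GL (Fin 2) K} {c : K} :
    A • (c : OnePoint K) = c ↔ A 1 0 * c ^ 2 + (A 1 1 - A 0 0) * c - A 0 1 = 0 := by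
  rw [← GeneralLinearGroup.fixpointPolynomial_aeval_eq_zero_iff]
  simp [GeneralLinearGroup.fixpointPolynomial]

/-- A Möbius transformation with three fixed points is the identity. -/
theorem moebius_scalar_of_three_fixed {A : GL (Fin 2) K} {s : Finset (OnePoint K)}
    (hs : 3 ≤ s.card) (h : ∀ z ∈ s, A • z = z) : A 0 1 = 0 ∧ A 1 0 = 0 ∧ A 0 0 = A 1 1 := by
  classical
  obtain ⟨t, hts, ht⟩ := Finset.exists_subset_card_eq hs
  obtain ⟨a, b, c, hab, hac, hbc, rfl⟩ := Finset.card_eq_three.1 ht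
  have ha := h a (hts (by simp))
  have hb := h b (hts (by simp))
  have hc := h c (hts (by simp))
  have key1 : ∀ {u v : K}, u ≠ v → A 1 0 = 0 → A • (u : OnePoint K) = u →
      A • (v : OnePoint K) = v → A 0 1 = 0 ∧ A 1 0 = 0 ∧ A 0 0 = A 1 1 := by
    intro u v huv h0 hu hv
    rw [smul_coe_eq_self_iff, h0] at hu hv
    have h1 : (A 1 1 - A 0 0) * (u - v) = 0 := by linear_combination hu - hv
    have h2 : A 1 1 - A 0 0 = 0 := by
      rcases mul_eq_zero.1 h1 with h | h
      · exact h
      · exact absurd (sub_eq_zero.1 h) huv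
    refine ⟨?_, h0, (sub_eq_zero.1 h2).symm⟩
    rw [h2] at hu
    linear_combination -hu
  cases a with
  | infty =>
    rw [OnePoint.smul_infty_eq_self_iff] at ha
    cases b with
    | infty => exact absurd rfl hab
    | coe b =>
      cases c with
      | infty => exact absurd rfl hac
      | coe c => exact key1 (fun h => hbc (by rw [h])) ha hb hc
  | coe a =>
    cases b with
    | infty =>
      rw [OnePoint.smul_infty_eq_self_iff] at hb
      cases c with
      | infty => exact absurd rfl hbc
      | coe c => exact key1 (fun h => hac (by rw [h])) hb ha hc
    | coe b =>
      cases c with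
      | infty =>
        rw [OnePoint.smul_infty_eq_self_iff] at hc
        exact key1 (fun h => hab (by rw [h])) hc ha hb
      | coe c =>
        have h0 : A 1 0 = 0 := by
          have ha' := smul_coe_eq_self_iff.1 ha
          have hb' := smul_coe_eq_self_iff.1 hb
          have hc' := smul_coe_eq_self_iff.1 hc
          have hab' : a - b ≠ 0 := sub_ne_zero.2 fun h => hab (by rw [h])
          have hac' : a - c ≠ 0 := sub_ne_zero.2 fun h => hac (by rw [h])
          have hbc' : b - c ≠ 0 := sub_ne_zero.2 fun h => hbc (by rw [h])
          have h1 : (a - b) * (A 1 0 * (a + b) + (A 1 1 - A 0 0)) = 0 := by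
            linear_combination ha' - hb'
          have h2 : (a - c) * (A 1 0 * (a + c) + (A 1 1 - A 0 0)) = 0 := by
            linear_combination ha' - hc'
          have h1' := (mul_eq_zero.1 h1).resolve_left hab'
          have h2' := (mul_eq_zero.1 h2).resolve_left hac'
          have h3 : A 1 0 * (b - c) = 0 := by linear_combination h1' - h2'
          exact (mul_eq_zero.1 h3).resolve_right hbc'
        exact key1 (fun h => hab (by rw [h])) h0 ha hb

theorem moebiusHom_eq_one_iff {A : GL (Fin 2) K} :
    moebiusHom K A = 1 ↔ A 0 1 = 0 ∧ A 1 0 = 0 ∧ A 0 0 = A 1 1 := by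
  constructor
  · intro h
    have h' : ∀ z : OnePoint K, A • z = z := fun z => congrArg (fun f => f z) h
    have h0 : A 1 0 = 0 := OnePoint.smul_infty_eq_self_iff.1 (h' _)
    have h1 := smul_coe_eq_self_iff.1 (h' ((0 : K) : OnePoint K))
    have h2 := smul_coe_eq_self_iff.1 (h' ((1 : K) : OnePoint K))
    rw [h0] at h1 h2
    have h3 : A 0 1 = 0 := by linear_combination -h1
    exact ⟨h3, h0, by linear_combination h1 - h2⟩
  · rintro ⟨h1, h2, h3⟩
    ext z
    change A • z = z
    cases z with
    | infty => rwa [OnePoint.smul_infty_eq_self_iff]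
    | coe z => rw [smul_coe_eq_self_iff, h1, h2, h3]; ring

theorem moebiusHom_eq_one_iff_scalar {A : GL (Fin 2) K} :
    moebiusHom K A = 1 ↔ A.val ∈ Set.range (scalar (Fin 2)) := by
  rw [moebiusHom_eq_one_iff]
  constructor
  · rintro ⟨h1, h2, h3⟩
    refine ⟨A 0 0, ?_⟩
    ext i j
    fin_cases i <;> fin_cases j <;> simp [h1, h2, h3]
  · rintro ⟨a, ha⟩
    simp [← ha]

theorem moebiusHom_eq_iff {A B : GL (Fin 2) K} :
    moebiusHom K A = moebiusHom K B ↔ ∃ u : K, A.val = u • B.val := by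
  constructor
  · intro h
    have h1 : moebiusHom K (A * B⁻¹) = 1 := by rw [map_mul, h, map_inv, mul_inv_cancel]
    obtain ⟨u, hu⟩ := moebiusHom_eq_one_iff_scalar.1 h1
    refine ⟨u, ?_⟩
    have : A.val = (A * B⁻¹).val * B.val := by
      rw [← Units.val_mul, inv_mul_cancel_right]
    rw [this, ← hu, scalar_apply, ← smul_eq_diagonal_mul]
  · rintro ⟨u, hu⟩
    have h1 : moebiusHom K (A * B⁻¹) = 1 := by
      refine moebiusHom_eq_one_iff_scalar.2 ⟨u, ?_⟩
      rw [Units.val_mul, hu, smul_mul, ← Units.val_mul, mul_inv_cancel, Units.val_one,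
        scalar_apply, ← smul_one_eq_diagonal]
    rw [map_mul, map_inv, mul_inv_eq_one] at h1
    exact h1

/-- A matrix whose discriminant is a nonzero square has exactly two fixed points. -/
theorem exists_two_fixed_points (h2 : (2 : K) ≠ 0) {A : GL (Fin 2) K} {d : K} (hd : d ≠ 0)
    (h : A.val.trace ^ 2 - 4 * A.val.det = d ^ 2) :
    ∃ P Q : OnePoint K, P ≠ Q ∧ A • P = P ∧ A • Q = Q := by
  rw [trace_fin_two, det_fin_two] at h
  by_cases h0 : A 1 0 = 0
  · have h3 : A 0 0 - A 1 1 ≠ 0 := by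
      intro h3
      apply hd
      rw [← sq_eq_zero_iff, ← h, h0]
      linear_combination (A 0 0 - A 1 1) * h3
    refine ⟨OnePoint.infty, ((A 0 1 / (A 1 1 - A 0 0) : K) : OnePoint K), by simp,
      OnePoint.smul_infty_eq_self_iff.2 h0, ?_⟩
    rw [smul_coe_eq_self_iff, h0]
    have : A 1 1 - A 0 0 ≠ 0 := by rwa [← neg_sub, neg_ne_zero]
    field_simp
    ring
  · refine ⟨(((A 0 0 - A 1 1 + d) / (2 * A 1 0) : K) : OnePoint K),
      (((A 0 0 - A 1 1 - d) / (2 * A 1 0) : K) : OnePoint K), ?_, ?_, ?_⟩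
    · rw [Ne, OnePoint.coe_eq_coe, div_left_inj' (mul_ne_zero h2 h0)]
      intro h3
      have : 2 * d = 0 := by linear_combination h3
      exact (mul_ne_zero h2 hd) this
    · rw [smul_coe_eq_self_iff]
      field_simp
      linear_combination -h
    · rw [smul_coe_eq_self_iff]
      field_simp
      linear_combination -h

end MoebiusBasics

/-! ### Burnside-type counting of orbits and stabilizers -/

section Counting

variable {G Ω : Type*} [Group G] [MulAction G Ω] [Fintype Ω]

theorem ncard_orbit_mul_card_stabilizer [Finite G] (P : Ω) :
    (orbit G P).ncard * Nat.card (stabilizer G P) = Nat.card G := by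
  classical
  have := Fintype.ofFinite G
  rw [← Nat.card_coe_set_eq, Nat.card_eq_fintype_card, Nat.card_eq_fintype_card,
    Nat.card_eq_fintype_card, card_orbit_mul_card_stabilizer_eq_card_group]

open Classical in
theorem card_filter_mem_orbit (P : Ω) :
    (Finset.univ.filter fun Q => Q ∈ orbit G P).card = (orbit G P).ncard := by
  rw [Set.ncard_eq_toFinset_card' (orbit G P)]
  congr 1
  ext; simp

open Classical in
theorem disjoint_filter_mem_orbit {A B : Ω} (h : B ∉ orbit G A) :
    Disjoint (Finset.univ.filter fun Q => Q ∈ orbit G A)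
      (Finset.univ.filter fun Q => Q ∈ orbit G B) := by
  rw [Finset.disjoint_left]
  intro Q hA hB
  replace hA := (Finset.mem_filter.1 hA).2
  replace hB := (Finset.mem_filter.1 hB).2
  exact h (by rw [← orbit_eq_iff.2 hA, orbit_eq_iff.2 hB]; exact mem_orbit_self B)

open Classical in
theorem sum_card_stabilizer_orbit [Finite G] (P : Ω) :
    ∑ Q with Q ∈ orbit G P, Nat.card (stabilizer G Q) = Nat.card G := by
  have h : ∀ Q ∈ Finset.univ.filter (fun Q => Q ∈ orbit G P),
      Nat.card (stabilizer G Q) = Nat.card (stabilizer G P) := by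
    intro Q hQ
    have hQ' : orbit G Q = orbit G P := orbit_eq_iff.2 (Finset.mem_filter.1 hQ).2
    have h1 := ncard_orbit_mul_card_stabilizer (G := G) P
    have h2 := ncard_orbit_mul_card_stabilizer (G := G) Q
    rw [hQ', ← h1] at h2
    exact Nat.eq_of_mul_eq_mul_left
      ((Set.ncard_pos (Set.toFinite _)).2 ⟨P, mem_orbit_self P⟩) h2
  rw [Finset.sum_congr rfl h, Finset.sum_const, smul_eq_mul,
    ← ncard_orbit_mul_card_stabilizer (G := G) P, card_filter_mem_orbit]

open Classical in
theorem sum_card_stabilizer_eq [Fintype G] :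
    ∑ Q : Ω, Nat.card (stabilizer G Q) =
      ∑ g : G, (Finset.univ.filter fun Q : Ω => g • Q = Q).card := by
  have h : ∀ Q : Ω, Nat.card (stabilizer G Q) =
      (Finset.univ.filter fun g : G => g • Q = Q).card := by
    intro Q
    rw [Nat.card_eq_fintype_card, Fintype.card_subtype]
    rfl
  simp_rw [h]
  exact Finset.sum_card_bipartiteAbove_eq_sum_card_bipartiteBelow _

-- In Burnside's sum the identity fixes all of Ω, and each of the other |G| − 1 elements at most two
-- points.
open Classical in
theorem sum_card_stabilizer_add_two_le [Finite G]
    (hfix : ∀ g : G, g ≠ 1 → (Finset.univ.filter fun Q : Ω => g • Q = Q).card ≤ 2) :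
    ∑ Q : Ω, Nat.card (stabilizer G Q) + 2 ≤ Fintype.card Ω + 2 * Nat.card G := by
  have := Fintype.ofFinite G
  rw [sum_card_stabilizer_eq, ← Finset.add_sum_erase _ _ (Finset.mem_univ (1 : G))]
  have h1 : ∑ g ∈ Finset.univ.erase (1 : G), (Finset.univ.filter fun Q : Ω => g • Q = Q).card ≤
      (Finset.univ.erase (1 : G)).card • 2 :=
    Finset.sum_le_card_nsmul _ _ _ fun g hg => hfix g (Finset.ne_of_mem_erase hg)
  rw [Finset.card_erase_of_mem (Finset.mem_univ _), Finset.card_univ, smul_eq_mul] at h1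
  have h2 : 0 < Fintype.card G := Fintype.card_pos
  simp only [one_smul, Finset.filter_true, Finset.card_univ, Nat.card_eq_fintype_card]
  omega

open Classical in
theorem le_sum_card_stabilizer_add_two [Finite G]
    (hfix : ∀ g : G, 2 ≤ (Finset.univ.filter fun Q : Ω => g • Q = Q).card) :
    Fintype.card Ω + 2 * Nat.card G ≤ ∑ Q : Ω, Nat.card (stabilizer G Q) + 2 := by
  have := Fintype.ofFinite G
  rw [sum_card_stabilizer_eq, ← Finset.add_sum_erase _ _ (Finset.mem_univ (1 : G))]
  have h1 : (Finset.univ.erase (1 : G)).card • 2 ≤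
      ∑ g ∈ Finset.univ.erase (1 : G), (Finset.univ.filter fun Q : Ω => g • Q = Q).card :=
    Finset.card_nsmul_le_sum _ _ _ fun g _ => hfix g
  rw [Finset.card_erase_of_mem (Finset.mem_univ _), Finset.card_univ, smul_eq_mul] at h1
  simp only [one_smul, Finset.filter_true, Finset.card_univ, Nat.card_eq_fintype_card]
  omega

open Classical in
/-- If every nontrivial element fixes at most two points, then three distinct orbits cannot be too
small. -/
theorem card_add_two_le_of_three_orbits [Finite G]
    (hfix : ∀ g : G, g ≠ 1 → (Finset.univ.filter fun Q : Ω => g • Q = Q).card ≤ 2)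
    {P₁ P₂ P₃ : Ω} (h₁₂ : P₂ ∉ orbit G P₁) (h₁₃ : P₃ ∉ orbit G P₁) (h₂₃ : P₃ ∉ orbit G P₂) :
    Nat.card G + 2 ≤ (orbit G P₁).ncard + (orbit G P₂).ncard + (orbit G P₃).ncard := by
  have hdisj : Disjoint ((Finset.univ.filter fun Q => Q ∈ orbit G P₁) ∪
      (Finset.univ.filter fun Q => Q ∈ orbit G P₂)) (Finset.univ.filter fun Q => Q ∈ orbit G P₃) :=
    Finset.disjoint_union_left.2 ⟨disjoint_filter_mem_orbit h₁₃, disjoint_filter_mem_orbit h₂₃⟩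
  set U := ((Finset.univ.filter fun Q => Q ∈ orbit G P₁) ∪
      (Finset.univ.filter fun Q => Q ∈ orbit G P₂)) ∪ (Finset.univ.filter fun Q => Q ∈ orbit G P₃)
    with hU
  have hUcard : U.card = (orbit G P₁).ncard + (orbit G P₂).ncard + (orbit G P₃).ncard := by
    rw [hU, Finset.card_union_of_disjoint hdisj,
      Finset.card_union_of_disjoint (disjoint_filter_mem_orbit h₁₂), card_filter_mem_orbit,
      card_filter_mem_orbit, card_filter_mem_orbit]
  have hUsum : ∑ Q ∈ U, Nat.card (stabilizer G Q) = Nat.card G + Nat.card G + Nat.card G := by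
    rw [hU, Finset.sum_union hdisj, Finset.sum_union (disjoint_filter_mem_orbit h₁₂),
      sum_card_stabilizer_orbit,
      sum_card_stabilizer_orbit, sum_card_stabilizer_orbit]
  -- Each orbit contributes |G| to the sum and each point outside at least 1, so 3|G| + |Ω| − |U| ≤
  -- |Ω| + 2|G| − 2.
  have hUc : Uᶜ.card • 1 ≤ ∑ Q ∈ Uᶜ, Nat.card (stabilizer G Q) :=
    Finset.card_nsmul_le_sum _ _ _ fun Q _ => Nat.card_pos
  have h1 := sum_card_stabilizer_add_two_le hfix
  rw [← Finset.sum_add_sum_compl U, hUsum] at h1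
  have h2 := Finset.card_add_card_compl U
  rw [smul_eq_mul] at hUc
  omega

open Classical in
/-- If every element fixes at least two points, then two distinct orbits that are not too small do
not contain all points with nontrivial stabilizer. -/
theorem exists_stabilizer_of_two_orbits [Finite G]
    (hfix : ∀ g : G, 2 ≤ (Finset.univ.filter fun Q : Ω => g • Q = Q).card)
    {P₁ P₂ : Ω} (h₁₂ : P₂ ∉ orbit G P₁) (h : 2 < (orbit G P₁).ncard + (orbit G P₂).ncard) :
    ∃ P₃, P₃ ∉ orbit G P₁ ∧ P₃ ∉ orbit G P₂ ∧ 2 ≤ Nat.card (stabilizer G P₃) := by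
  by_contra! hcon
  have hdisj := disjoint_filter_mem_orbit h₁₂
  set U := (Finset.univ.filter fun Q => Q ∈ orbit G P₁) ∪
      (Finset.univ.filter fun Q => Q ∈ orbit G P₂) with hU
  have hUcard : U.card = (orbit G P₁).ncard + (orbit G P₂).ncard := by
    rw [hU, Finset.card_union_of_disjoint hdisj, card_filter_mem_orbit, card_filter_mem_orbit]
  have hUsum : ∑ Q ∈ U, Nat.card (stabilizer G Q) = Nat.card G + Nat.card G := by
    rw [hU, Finset.sum_union hdisj, sum_card_stabilizer_orbit, sum_card_stabilizer_orbit]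
  -- With only trivial stabilizers outside U the sum is at most 2|G| + |Ω| − |U|, while it is at
  -- least |Ω| + 2|G| − 2; so |U| ≤ 2.
  have hUc : ∑ Q ∈ Uᶜ, Nat.card (stabilizer G Q) ≤ Uᶜ.card • 1 := by
    refine Finset.sum_le_card_nsmul _ _ _ fun Q hQ => ?_
    simp only [hU, Finset.compl_union, Finset.mem_inter, Finset.mem_compl, Finset.mem_filter,
      Finset.mem_univ, true_and] at hQ
    exact Nat.lt_succ_iff.1 (hcon Q hQ.1 hQ.2)
  have h1 := le_sum_card_stabilizer_add_two hfix
  rw [← Finset.sum_add_sum_compl U, hUsum] at h1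
  have h2 := Finset.card_add_card_compl U
  rw [smul_eq_mul] at hUc
  omega

end Counting

/-! ### Eigenpoints outside the base field -/

section Elliptic

variable {F L : Type*} [Field F] [Field L] [Algebra F L]

/-- `(P, 1)` is an eigenvector of `M` with eigenvalue `ζ`. -/
def IsEigenpoint (M : GL (Fin 2) F) (P ζ : L) : Prop :=
  algebraMap F L (M 1 0) * P + algebraMap F L (M 1 1) = ζ ∧
    algebraMap F L (M 0 0) * P + algebraMap F L (M 0 1) = ζ * P

theorem IsEigenpoint.mul {M N : GL (Fin 2) F} {P ζ μ : L} (h : IsEigenpoint M P ζ)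
    (h' : IsEigenpoint N P μ) : IsEigenpoint (M * N) P (ζ * μ) := by
  obtain ⟨h1, h2⟩ := h
  obtain ⟨h3, h4⟩ := h'
  rw [IsEigenpoint, Units.val_mul]
  simp only [mul_apply, Fin.sum_univ_two, map_add, map_mul]
  constructor
  · linear_combination (algebraMap F L (M 1 0)) * h4 + (algebraMap F L (M 1 1)) * h3 + μ * h1
  · linear_combination (algebraMap F L (M 0 0)) * h4 + (algebraMap F L (M 0 1)) * h3 + μ * h2

theorem IsEigenpoint.pow {M : GL (Fin 2) F} {P ζ : L} (h : IsEigenpoint M P ζ) (i : ℕ) :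
    IsEigenpoint (M ^ i) P (ζ ^ i) := by
  induction i with
  | zero => simp [IsEigenpoint]
  | succ i ih => rw [pow_succ, pow_succ]; exact ih.mul h

theorem eq_zero_of_linear_eq_zero {P : L} (hP : P ∉ Set.range (algebraMap F L)) {u v : F}
    (h : algebraMap F L u * P + algebraMap F L v = 0) : u = 0 ∧ v = 0 := by
  have hu : u = 0 := by
    by_contra hu
    have hu' : algebraMap F L u ≠ 0 := by simpa using hu
    refine hP ⟨-v / u, ?_⟩
    rw [map_div₀, map_neg, div_eq_iff hu']
    linear_combination -h
  refine ⟨hu, ?_⟩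
  rw [hu, map_zero, zero_mul, zero_add] at h
  simpa using h

/-- As 1 and P are linearly independent over F, the eigenvalue determines both rows: the matrices
fixing P embed in the multiplicative group of L. -/
theorem IsEigenpoint.unique {M N : GL (Fin 2) F} {P ζ : L}
    (hP : P ∉ Set.range (algebraMap F L)) (h : IsEigenpoint M P ζ) (h' : IsEigenpoint N P ζ) :
    M = N := by
  obtain ⟨h1, h2⟩ := eq_zero_of_linear_eq_zero hP (u := M 1 0 - N 1 0) (v := M 1 1 - N 1 1)
    (by simp only [map_sub]; linear_combination h.1 - h'.1)
  obtain ⟨h3, h4⟩ := eq_zero_of_linear_eq_zero hP (u := M 0 0 - N 0 0) (v := M 0 1 - N 0 1)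
    (by simp only [map_sub]; linear_combination h.2 - h'.2)
  ext i j
  fin_cases i <;> fin_cases j
  · exact sub_eq_zero.1 h3
  · exact sub_eq_zero.1 h4
  · exact sub_eq_zero.1 h1
  · exact sub_eq_zero.1 h2

theorem IsEigenpoint.quadratic {M : GL (Fin 2) F} (hM : M.val.det = 1) {P ζ : L}
    (h : IsEigenpoint M P ζ) : ζ ^ 2 - algebraMap F L M.val.trace * ζ + 1 = 0 := by
  obtain ⟨h1, h2⟩ := h
  have hdet := congrArg (algebraMap F L) hM
  rw [det_fin_two, map_sub, map_mul, map_mul, map_one] at hdet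
  rw [trace_fin_two, map_add, ← hdet]
  linear_combination (-ζ + algebraMap F L (M 0 0)) * h1 - (algebraMap F L (M 1 0)) * h2

theorem IsEigenpoint.ne_zero {M : GL (Fin 2) F} (hM : M.val.det = 1) {P ζ : L}
    (h : IsEigenpoint M P ζ) : ζ ≠ 0 := by
  rintro rfl
  simpa using h.quadratic hM

variable [DecidableEq F]

theorem IsEigenpoint.moebiusHom_eq_one_iff {N : GL (Fin 2) F} (hN : N.val.det = 1) {P μ : L}
    (hP : P ∉ Set.range (algebraMap F L)) (h : IsEigenpoint N P μ) :
    moebiusHom F N = 1 ↔ μ ^ 2 = 1 := by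
  obtain ⟨h1, h2⟩ := h
  rw [_root_.moebiusHom_eq_one_iff]
  rw [det_fin_two] at hN
  constructor
  · rintro ⟨h3, h4, h5⟩
    rw [h4, map_zero, zero_mul, zero_add] at h1
    rw [← h1, ← map_pow, ← map_one (algebraMap F L)]
    congr 1
    rw [h3, h4, h5] at hN
    linear_combination hN
  · intro h3
    have : ∃ e : F, algebraMap F L e = μ := by
      rcases sq_eq_one_iff.1 h3 with h | h
      · exact ⟨1, by simp [h]⟩
      · exact ⟨-1, by simp [h]⟩
    obtain ⟨e, rfl⟩ := this
    obtain ⟨h4, h5⟩ := eq_zero_of_linear_eq_zero hP (u := N 1 0) (v := N 1 1 - e)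
      (by rw [map_sub]; linear_combination h1)
    obtain ⟨h6, h7⟩ := eq_zero_of_linear_eq_zero hP (u := N 0 0 - e) (v := N 0 1)
      (by rw [map_sub]; linear_combination h2)
    exact ⟨h7, h4, by linear_combination h6 - h5⟩

/-- A fixed point over F yields a root of the characteristic polynomial in F; the other root, the
trace minus it, lies in F too, and μ is one of the two. -/
theorem IsEigenpoint.mem_range_of_fixed {N : GL (Fin 2) F} (hN : N.val.det = 1) {P μ : L}
    (h : IsEigenpoint N P μ) {z : OnePoint F} (hz : N • z = z) :
    μ ∈ Set.range (algebraMap F L) := by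
  have hq := h.quadratic hN
  obtain ⟨e, he⟩ : ∃ e : F, e ^ 2 - N.val.trace * e + 1 = 0 := by
    rw [det_fin_two] at hN
    rw [trace_fin_two]
    cases z with
    | infty =>
      rw [OnePoint.smul_infty_eq_self_iff] at hz
      refine ⟨N 0 0, ?_⟩
      rw [hz] at hN
      linear_combination -hN
    | coe c =>
      rw [smul_coe_eq_self_iff] at hz
      refine ⟨N 1 0 * c + N 1 1, ?_⟩
      linear_combination -hN + N 1 0 * hz
  replace he := congrArg (algebraMap F L) he
  simp only [map_add, map_sub, map_mul, map_pow, map_one, map_zero] at he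
  have h1 : (μ - algebraMap F L e) *
      (μ - algebraMap F L (N.val.trace - e)) = 0 := by
    rw [map_sub]
    linear_combination hq - he
  rcases mul_eq_zero.1 h1 with h2 | h2
  · exact ⟨e, (sub_eq_zero.1 h2).symm⟩
  · exact ⟨_, (sub_eq_zero.1 h2).symm⟩

/-- All orbits of the powers of `c` have size `n`. -/
def IsSemiregularOfOrder {S : Type*} (c : Equiv.Perm S) (n : ℕ) : Prop :=
  ∀ (i : ℕ) (z : S), (c ^ i) z = z ↔ n ∣ i

theorem IsSemiregularOfOrder.pow_eq_one_iff {S : Type*} [Nonempty S] {c : Equiv.Perm S} {n : ℕ}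
    (h : IsSemiregularOfOrder c n) (i : ℕ) : c ^ i = 1 ↔ n ∣ i := by
  constructor
  · intro hi
    exact (h i (Classical.arbitrary S)).1 (by rw [hi]; rfl)
  · intro hi
    ext z
    exact (h i z).2 hi

end Elliptic

/-! ### Elliptic elements over F_p and roots of unity in the field with p² elements -/

section FiniteElliptic

variable {p : ℕ} [Fact p.Prime] {L : Type*} [Field L] [Algebra (ZMod p) L]

theorem pow_eq_self_of_mem_range {μ : L} (h : μ ∈ Set.range (algebraMap (ZMod p) L)) :
    μ ^ p = μ := by
  obtain ⟨e, rfl⟩ := h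
  rw [← map_pow, ZMod.pow_card]

theorem two_ne_zero_of_algebra (hp : 3 < p) : (2 : L) ≠ 0 := by
  have : CharP L p := charP_of_injective_algebraMap (algebraMap (ZMod p) L).injective p
  intro h
  have h' : ((2 : ℕ) : L) = 0 := by exact_mod_cast h
  rw [CharP.cast_eq_zero_iff L p] at h'
  have := Nat.le_of_dvd (by norm_num) h'
  omega

/-- A matrix with eigenvalue of norm one whose square has order `n` acts semiregularly. -/
theorem IsEigenpoint.isSemiregular {n : ℕ} (hn : 2 * n = p + 1) {M : GL (Fin 2) (ZMod p)}
    (hM : M.val.det = 1) {P ζ : L} (hP : P ∉ Set.range (algebraMap (ZMod p) L))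
    (h : IsEigenpoint M P ζ) (hζ : IsPrimitiveRoot (ζ ^ 2) n) :
    IsSemiregularOfOrder (moebiusHom (ZMod p) M) n := by
  have hdet : ∀ i : ℕ, (M ^ i).val.det = 1 := fun i => by
    rw [Units.val_pow_eq_pow_val, det_pow, hM, one_pow]
  intro i z
  rw [← hζ.pow_eq_one_iff_dvd, ← map_pow]
  constructor
  · intro hz
    -- Frobenius fixes ζ^i, which lies in the prime field, but also inverts it because ζ^(p+1) = 1.
    have h1 := pow_eq_self_of_mem_range ((h.pow i).mem_range_of_fixed (hdet i) (z := z) hz)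
    have h2 : ζ ^ (p + 1) = 1 := by rw [← hn, pow_mul, hζ.pow_eq_one]
    calc (ζ ^ 2) ^ i = ζ ^ i * ζ ^ i := by ring
      _ = (ζ ^ i) ^ p * ζ ^ i := by rw [h1]
      _ = (ζ ^ (p + 1)) ^ i := by ring
      _ = 1 := by rw [h2, one_pow]
  · intro hz
    have := ((h.pow i).moebiusHom_eq_one_iff (hdet i) hP).2 (by rw [← hz]; ring)
    rw [this]; rfl

variable [Fintype L]

/-- Euler's criterion: (p² − 1)/2 is a multiple of p − 1. -/
theorem isSquare_algebraMap (hp : 3 < p) (hL : Fintype.card L = p ^ 2) (e : ZMod p) :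
    IsSquare (algebraMap (ZMod p) L e) := by
  by_cases he : e = 0
  · simp [he]
  have hc : ringChar L ≠ 2 := by
    intro h
    have h2 : ((2 : ℕ) : L) = 0 := by rw [← h]; exact ringChar.Nat.cast_ringChar
    exact two_ne_zero_of_algebra (L := L) hp (by exact_mod_cast h2)
  rw [FiniteField.isSquare_iff hc (by simpa using he), hL]
  have hodd : Odd p := (Fact.out : p.Prime).odd_of_ne_two (by omega)
  obtain ⟨k, hk⟩ := hodd
  have : p ^ 2 / 2 = (p - 1) * (k + 1) := by
    rw [hk]
    have : (2 * k + 1) ^ 2 = 2 * (2 * k * (k + 1)) + 1 := by ring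
    rw [this]
    simp only [Nat.add_sub_cancel]
    omega
  rw [this, pow_mul, ← map_pow, ZMod.pow_card_sub_one_eq_one he, map_one, one_pow]

/-- Euler's criterion again, now with (p² − 1)/2 = n(p − 1). -/
theorem isSquare_of_pow_eq_one (hp : 3 < p) (hL : Fintype.card L = p ^ 2) {n : ℕ}
    (hn : 2 * n = p + 1) {w : L} (hw : w ^ n = 1) : IsSquare w := by
  have hw0 : w ≠ 0 := by
    rintro rfl
    rw [zero_pow (by omega)] at hw
    exact zero_ne_one hw
  have hc : ringChar L ≠ 2 := by
    intro h
    have h2 : ((2 : ℕ) : L) = 0 := by rw [← h]; exact ringChar.Nat.cast_ringChar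
    exact two_ne_zero_of_algebra (L := L) hp (by exact_mod_cast h2)
  rw [FiniteField.isSquare_iff hc hw0, hL]
  have : p ^ 2 / 2 = n * (p - 1) := by
    obtain ⟨m, rfl⟩ : ∃ m, n = m + 1 := ⟨n - 1, by omega⟩
    obtain rfl : p = 2 * m + 1 := by omega
    have : (2 * m + 1) ^ 2 = 2 * ((m + 1) * (2 * m)) + 1 := by ring
    rw [this]
    simp only [Nat.add_sub_cancel]
    omega
  rw [this, pow_mul, hw, one_pow]

/-- The trace selects the sign of the square root ζ of w. If ζ were in F_p, then 1 = ζ^(p+1) = ζ² =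
w. So M has no eigenvalue in F_p, its lower left entry is nonzero, and the lower row can be solved
for P. -/
theorem exists_isEigenpoint_of_trace (hp : 3 < p) (hL : Fintype.card L = p ^ 2) {n : ℕ}
    (hn : 2 * n = p + 1) {M : GL (Fin 2) (ZMod p)} (hM : M.val.det = 1) {w : L}
    (hw : IsPrimitiveRoot w n) (ht : algebraMap (ZMod p) L M.val.trace ^ 2 = w + w⁻¹ + 2) :
    ∃ P ζ : L, P ∉ Set.range (algebraMap (ZMod p) L) ∧ IsEigenpoint M P ζ ∧ ζ ^ 2 = w := by
  obtain ⟨u, hu⟩ := isSquare_of_pow_eq_one hp hL hn hw.pow_eq_one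
  have hw0 : w ≠ 0 := hw.ne_zero (by omega)
  have hu0 : u ≠ 0 := by rintro rfl; simp [hu] at hw0
  obtain ⟨ζ, hζ2, hζ⟩ : ∃ ζ : L, ζ ^ 2 = w ∧ algebraMap (ZMod p) L M.val.trace = ζ + ζ⁻¹ := by
    have : algebraMap (ZMod p) L M.val.trace ^ 2 = (u + u⁻¹) ^ 2 := by
      rw [ht, hu]; field_simp; ring
    rcases sq_eq_sq_iff_eq_or_eq_neg.1 this with h | h
    · exact ⟨u, by rw [hu]; ring, h⟩
    · exact ⟨-u, by rw [hu]; ring, by rw [h, inv_neg]; ring⟩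
  have hζ0 : ζ ≠ 0 := by rintro rfl; simp [← hζ2] at hw0
  have hζF : ζ ∉ Set.range (algebraMap (ZMod p) L) := by
    intro h
    have h1 := pow_eq_self_of_mem_range h
    have h2 : ζ ^ (p + 1) = 1 := by rw [← hn, pow_mul, hζ2, hw.pow_eq_one]
    rw [pow_succ, h1, ← sq, hζ2] at h2
    have := hw.dvd_of_pow_eq_one 1 (by rw [pow_one, h2])
    have := Nat.le_of_dvd one_pos this
    omega
  set f := algebraMap (ZMod p) L with hf
  have hdet := congrArg f hM
  rw [det_fin_two, map_sub, map_mul, map_mul, map_one] at hdet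
  rw [trace_fin_two, map_add] at hζ
  have hζ' : ζ ^ 2 - (f (M 0 0) + f (M 1 1)) * ζ + 1 = 0 := by
    rw [hζ]; field_simp; ring
  have h10 : f (M 1 0) ≠ 0 := by
    intro h0
    have h1 : (ζ - f (M 0 0)) * (ζ - f (M 1 1)) = 0 := by
      linear_combination hζ' + hdet + f (M 0 1) * h0
    rcases mul_eq_zero.1 h1 with h2 | h2
    · exact hζF ⟨_, (sub_eq_zero.1 h2).symm⟩
    · exact hζF ⟨_, (sub_eq_zero.1 h2).symm⟩
  refine ⟨(ζ - f (M 1 1)) / f (M 1 0), ζ, ?_, ⟨?_, ?_⟩, hζ2⟩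
  · rintro ⟨e, he⟩
    rw [eq_div_iff h10] at he
    exact hζF ⟨e * M 1 0 + M 1 1, by rw [map_add, map_mul]; linear_combination he⟩
  · rw [← hf]; field_simp; ring
  · rw [← hf]; field_simp; linear_combination -hζ' - hdet

/-- Since n > 1 there is no fixed point over F_p, but the discriminant is a square in L, so a fixed
point P appears there. A power of M is trivial exactly when its eigenvalue at P is ±1, which
identifies the order of ζ². -/
theorem IsSemiregularOfOrder.exists_isEigenpoint (hp : 3 < p) (hL : Fintype.card L = p ^ 2) {n : ℕ}
    (hn : 2 * n = p + 1) {M : GL (Fin 2) (ZMod p)} (hM : M.val.det = 1)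
    (h : IsSemiregularOfOrder (moebiusHom (ZMod p) M) n) :
    ∃ P ζ : L, P ∉ Set.range (algebraMap (ZMod p) L) ∧ IsEigenpoint M P ζ ∧
      IsPrimitiveRoot (ζ ^ 2) n := by
  have hnofix : ∀ z : OnePoint (ZMod p), M • z ≠ z := by
    intro z hz
    have := Nat.le_of_dvd one_pos ((h 1 z).1 (by rw [pow_one]; exact hz))
    omega
  have h2 : (2 : L) ≠ 0 := two_ne_zero_of_algebra hp
  set f := algebraMap (ZMod p) L with hf
  obtain ⟨d, hd⟩ := isSquare_algebraMap (L := L) hp hL (M.val.trace ^ 2 - 4)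
  have hdet := congrArg f hM
  rw [det_fin_two, map_sub, map_mul, map_mul, map_one] at hdet
  rw [trace_fin_two, map_sub, map_pow, map_add, map_ofNat, ← hf] at hd
  have h10 : M 1 0 ≠ 0 := fun h0 => hnofix OnePoint.infty (OnePoint.smul_infty_eq_self_iff.2 h0)
  have h10' : f (M 1 0) ≠ 0 := by simpa using h10
  obtain ⟨P, hPdef⟩ : ∃ P, P = (f (M 0 0) - f (M 1 1) + d) / (2 * f (M 1 0)) := ⟨_, rfl⟩
  have hPq : f (M 1 0) * P ^ 2 + (f (M 1 1) - f (M 0 0)) * P - f (M 0 1) = 0 := by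
    rw [hPdef]
    field_simp
    linear_combination -hd + 4 * hdet
  have hPF : P ∉ Set.range f := by
    rintro ⟨c, rfl⟩
    refine hnofix (c : OnePoint (ZMod p)) (smul_coe_eq_self_iff.2 ?_)
    apply f.injective
    simpa using hPq
  have hE : IsEigenpoint M P (f (M 1 0) * P + f (M 1 1)) :=
    ⟨rfl, by rw [← hf]; linear_combination -hPq⟩
  refine ⟨P, _, hPF, hE, ?_⟩
  have key : ∀ i : ℕ, ((f (M 1 0) * P + f (M 1 1)) ^ 2) ^ i = 1 ↔ n ∣ i := by
    intro i
    rw [← h.pow_eq_one_iff, ← map_pow, (hE.pow i).moebiusHom_eq_one_iff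
      (by rw [Units.val_pow_eq_pow_val, det_pow, hM, one_pow]) hPF, ← pow_mul, ← pow_mul,
      Nat.mul_comm 2 i]
  exact ⟨(key n).2 dvd_rfl, fun l hl => (key l).1 hl⟩

end FiniteElliptic

/-! ### The projective line over an extension field -/

theorem OnePoint.card_zmod (p : ℕ) [Fact p.Prime] : Nat.card (OnePoint (ZMod p)) = p + 1 := by
  rw [Nat.card_eq_fintype_card]
  exact (Fintype.card_option).trans (by rw [ZMod.card])

/-- The action of `GL(2,F)` on the projective line over an extension of `F`. -/
def moebiusExt (F L : Type*) [Field F] [Field L] [Algebra F L] [DecidableEq L] :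
    GL (Fin 2) F →* Equiv.Perm (OnePoint L) :=
  (moebiusHom L).comp (GeneralLinearGroup.map (algebraMap F L))

section Ext

variable {F L : Type*} [Field F] [Field L] [Algebra F L]

theorem OnePoint.map_algebraMap_injective :
    Function.Injective (OnePoint.map (algebraMap F L)) :=
  Option.map_injective (algebraMap F L).injective

theorem OnePoint.ncard_range_map {p : ℕ} [Fact p.Prime] [Algebra (ZMod p) L] :
    (Set.range (OnePoint.map (algebraMap (ZMod p) L))).ncard = p + 1 := by
  rw [← Set.image_univ, Set.ncard_image_of_injective _ OnePoint.map_algebraMap_injective,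
    Set.ncard_univ, OnePoint.card_zmod]

variable [DecidableEq L]

theorem moebiusExt_coe_eq_self_iff {A : GL (Fin 2) F} {P : L} :
    moebiusExt F L A (P : OnePoint L) = P ↔
      IsEigenpoint A P (algebraMap F L (A 1 0) * P + algebraMap F L (A 1 1)) := by
  refine (smul_coe_eq_self_iff (A := GeneralLinearGroup.map (algebraMap F L) A)).trans ?_
  simp only [GeneralLinearGroup.map_apply, IsEigenpoint, true_and]
  constructor
  · intro h; linear_combination -h
  · intro h; linear_combination -h

theorem IsEigenpoint.moebiusExt_fix {A : GL (Fin 2) F} {P ζ : L} (h : IsEigenpoint A P ζ) :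
    moebiusExt F L A (P : OnePoint L) = P := by
  rw [moebiusExt_coe_eq_self_iff, h.1]
  exact h

/-- Möbius transformations over `F` with a common fixed point outside of `F` commute. -/
theorem commute_of_common_fixed_point {A B : GL (Fin 2) F} {P : L}
    (hP : P ∉ Set.range (algebraMap F L)) (hA : moebiusExt F L A (P : OnePoint L) = P)
    (hB : moebiusExt F L B (P : OnePoint L) = P) : A * B = B * A := by
  rw [moebiusExt_coe_eq_self_iff] at hA hB
  exact (hA.mul hB).unique hP (by rw [mul_comm]; exact hB.mul hA)

variable [DecidableEq F]

theorem moebiusExt_eq_one_iff {A : GL (Fin 2) F} : moebiusExt F L A = 1 ↔ moebiusHom F A = 1 := by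
  rw [moebiusExt, MonoidHom.comp_apply, moebiusHom_eq_one_iff, moebiusHom_eq_one_iff]
  simp

theorem moebiusExt_map (A : GL (Fin 2) F) (z : OnePoint F) :
    moebiusExt F L A (OnePoint.map (algebraMap F L) z) =
      OnePoint.map (algebraMap F L) (moebiusHom F A z) :=
  (OnePoint.map_smul (algebraMap F L) A z).symm

end Ext

/-! ### Orbits of the generated group over L: transitivity and parabolic elements -/

section TriangleGroup

variable {p : ℕ} [Fact p.Prime] {L : Type*} [Field L] [Algebra (ZMod p) L] [DecidableEq L]

theorem det_eq_one_of_mem_closure {K : Type*} [Field K] {s : Set (GL (Fin 2) K)}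
    (hs : ∀ A ∈ s, A.val.det = 1) {A : GL (Fin 2) K} (hA : A ∈ Subgroup.closure s) :
    A.val.det = 1 := by
  have h : Subgroup.closure s ≤ (GeneralLinearGroup.det (n := Fin 2) (R := K)).ker := by
    rw [Subgroup.closure_le]
    intro B hB
    exact Units.ext (hs B hB)
  exact congrArg Units.val (h hA)

variable {X Y : GL (Fin 2) (ZMod p)} {P ζ : L} {n : ℕ}

variable (L) in
/-- The group generated by two Möbius transformations over `ZMod p`, acting on the projective line
over `L`. -/
def extGroup (X Y : GL (Fin 2) (ZMod p)) : Subgroup (Equiv.Perm (OnePoint L)) :=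
  (Subgroup.closure {X, Y}).map (moebiusExt (ZMod p) L)

theorem moebiusExt_mem_extGroup {A : GL (Fin 2) (ZMod p)} (hA : A ∈ Subgroup.closure {X, Y}) :
    moebiusExt (ZMod p) L A ∈ extGroup L X Y := Subgroup.mem_map_of_mem _ hA

theorem apply_mem_orbit_extGroup {A : GL (Fin 2) (ZMod p)} (hA : A ∈ Subgroup.closure {X, Y})
    {Q R : OnePoint L} (hQ : Q ∈ orbit (extGroup L X Y) R) :
    moebiusExt (ZMod p) L A Q ∈ orbit (extGroup L X Y) R := by
  rw [← orbit_eq_iff.2 hQ]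
  exact mem_orbit Q (⟨_, moebiusExt_mem_extGroup hA⟩ : extGroup L X Y)

theorem left_mem_closure_pair : X ∈ Subgroup.closure {X, Y} :=
  Subgroup.subset_closure (by simp)

theorem right_mem_closure_pair : Y ∈ Subgroup.closure {X, Y} :=
  Subgroup.subset_closure (by simp)

theorem mem_range_map_of_mem_orbit {z : OnePoint (ZMod p)} {Q : OnePoint L}
    (hQ : Q ∈ orbit (extGroup L X Y) (OnePoint.map (algebraMap (ZMod p) L) z)) :
    ∃ A ∈ Subgroup.closure {X, Y}, OnePoint.map (algebraMap (ZMod p) L) (moebiusHom _ A z) = Q := by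
  obtain ⟨⟨_, A, hA, rfl⟩, rfl⟩ := hQ
  exact ⟨A, hA, (moebiusExt_map A z).symm⟩

theorem coe_notMem_orbit_map (hP : P ∉ Set.range (algebraMap (ZMod p) L)) (z : OnePoint (ZMod p)) :
    (P : OnePoint L) ∉ orbit (extGroup L X Y) (OnePoint.map (algebraMap (ZMod p) L) z) := by
  intro h
  obtain ⟨A, -, hA⟩ := mem_range_map_of_mem_orbit h
  cases hz : moebiusHom _ A z with
  | infty => rw [hz] at hA; exact OnePoint.infty_ne_coe _ hA
  | coe e => rw [hz] at hA; exact hP ⟨e, OnePoint.coe_injective hA⟩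

theorem orbit_map_subset_range (z : OnePoint (ZMod p)) :
    orbit (extGroup L X Y) (OnePoint.map (algebraMap (ZMod p) L) z) ⊆
      Set.range (OnePoint.map (algebraMap (ZMod p) L)) := by
  intro Q hQ
  obtain ⟨A, -, h⟩ := mem_range_map_of_mem_orbit hQ
  exact ⟨_, h⟩

variable [Fintype L]

open Classical in
theorem card_fixed_le_two (g : extGroup L X Y) (hg : g ≠ 1) :
    (Finset.univ.filter fun Q : OnePoint L => g • Q = Q).card ≤ 2 := by
  obtain ⟨_, A, hA, rfl⟩ := g
  by_contra! h
  have h1 := moebius_scalar_of_three_fixed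
    (A := GeneralLinearGroup.map (algebraMap (ZMod p) L) A) h
    (fun z hz => (Finset.mem_filter.1 hz).2)
  rw [← moebiusHom_eq_one_iff] at h1
  exact hg (Subtype.ext h1)

/-- The stabilizer of the fixed point `P` of a semiregular element is large. -/
theorem mul_ncard_orbit_le
    (hE : IsEigenpoint (Y * X) P ζ) (hc : IsSemiregularOfOrder (moebiusHom (ZMod p) (Y * X)) n) :
    n * (orbit (extGroup L X Y) (P : OnePoint L)).ncard ≤ Nat.card (extGroup L X Y) := by
  let c : extGroup L X Y := ⟨moebiusExt (ZMod p) L (Y * X),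
    moebiusExt_mem_extGroup (mul_mem right_mem_closure_pair left_mem_closure_pair)⟩
  let c' : stabilizer (extGroup L X Y) (P : OnePoint L) := ⟨c, hE.moebiusExt_fix⟩
  have hc' : ∀ i : ℕ, c' ^ i = 1 ↔ n ∣ i := by
    intro i
    rw [← hc.pow_eq_one_iff, ← map_pow, ← moebiusExt_eq_one_iff (L := L), map_pow, Subtype.ext_iff,
      Subtype.ext_iff]
    rfl
  have hord : orderOf c' = n :=
    Nat.dvd_antisymm (orderOf_dvd_of_pow_eq_one ((hc' n).2 dvd_rfl))
      ((hc' _).1 (pow_orderOf_eq_one c'))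
  rw [← ncard_orbit_mul_card_stabilizer (G := extGroup L X Y) (P : OnePoint L), mul_comm]
  refine Nat.mul_le_mul_left _ ?_
  rw [← hord]
  exact orderOf_le_card

/-- If Y fixes P, so does X, because YX does; then X and Y commute, (YX)⁶ = 1 and n divides 6. This
leaves n = 3, where (YX)³ = X would be trivial. Hence Y moves P in a 3-cycle. -/
theorem three_le_ncard_orbit (hP : P ∉ Set.range (algebraMap (ZMod p) L))
    (hx : moebiusHom (ZMod p) X ^ 2 = 1) (hx1 : moebiusHom (ZMod p) X ≠ 1)
    (hy : moebiusHom (ZMod p) Y ^ 3 = 1) (hE : IsEigenpoint (Y * X) P ζ)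
    (hc : IsSemiregularOfOrder (moebiusHom (ZMod p) (Y * X)) n) (hn : 3 ≤ n) (hn6 : n ≠ 6) :
    3 ≤ (orbit (extGroup L X Y) (P : OnePoint L)).ncard := by
  by_cases hyP : moebiusExt (ZMod p) L Y (P : OnePoint L) = P
  · exfalso
    have hxP : moebiusExt (ZMod p) L X (P : OnePoint L) = P := by
      have h1 := hE.moebiusExt_fix
      rw [map_mul, Equiv.Perm.mul_apply] at h1
      exact (moebiusExt (ZMod p) L Y).injective (h1.trans hyP.symm)
    have hcomm := congrArg (moebiusHom (ZMod p)) (commute_of_common_fixed_point hP hyP hxP)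
    rw [map_mul, map_mul] at hcomm
    have hcomm' : Commute (moebiusHom (ZMod p) Y) (moebiusHom (ZMod p) X) := hcomm
    have h3 : moebiusHom (ZMod p) (Y * X) ^ 3 = moebiusHom (ZMod p) X := by
      rw [map_mul, hcomm'.mul_pow, hy, one_mul, pow_succ, hx, one_mul]
    have h6 : moebiusHom (ZMod p) (Y * X) ^ 6 = 1 := by
      rw [show 6 = 3 * 2 from rfl, pow_mul, h3, hx]
    rw [hc.pow_eq_one_iff] at h6
    have hn3 : n ≠ 3 := by
      rintro rfl
      exact hx1 (h3.symm.trans ((hc.pow_eq_one_iff 3).2 dvd_rfl))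
    have := Nat.le_of_dvd (by norm_num) h6
    interval_cases n <;> omega
  · set e := moebiusExt (ZMod p) L Y with he
    have hy3 : ∀ Q, e (e (e Q)) = Q := by
      intro Q
      have : e ^ 3 = 1 := by
        rw [he, ← map_pow, moebiusExt_eq_one_iff, map_pow, hy]
      exact congrArg (fun f => f Q) this
    have h0 := mem_orbit_self (M := extGroup L X Y) (P : OnePoint L)
    have h1 := apply_mem_orbit_extGroup right_mem_closure_pair h0
    have h2 := apply_mem_orbit_extGroup right_mem_closure_pair h1
    have hd1 : e (e P) ≠ e P := fun h => hyP (e.injective h)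
    have hd2 : e (e P) ≠ P := fun h => hyP (by have h3 := hy3 P; rwa [h] at h3)
    have hsub : ({(P : OnePoint L), e P, e (e P)} : Set (OnePoint L)) ⊆
        orbit (extGroup L X Y) (P : OnePoint L) := by
      rintro Q (rfl | rfl | rfl) <;> assumption
    rw [← Set.ncard_eq_three.2 ⟨_, _, _, fun h => hyP h.symm, fun h => hd2 h.symm,
      fun h => hd1 h.symm, rfl⟩]
    exact Set.ncard_le_ncard hsub (Set.toFinite _)

/-- Two orbits over F_p have at most 2n points together. With the orbit of P, of size j ≥ 3, they
would give |G| + 2 ≤ 2n + j; since nj ≤ |G|, this means (n − 1)(j − 2) ≤ 0. -/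
theorem transitive_of_isEigenpoint (hP : P ∉ Set.range (algebraMap (ZMod p) L))
    (hx : moebiusHom (ZMod p) X ^ 2 = 1) (hx1 : moebiusHom (ZMod p) X ≠ 1)
    (hy : moebiusHom (ZMod p) Y ^ 3 = 1) (hE : IsEigenpoint (Y * X) P ζ)
    (hc : IsSemiregularOfOrder (moebiusHom (ZMod p) (Y * X)) n) (hn : 3 ≤ n) (hn6 : n ≠ 6)
    (hnp : 2 * n = p + 1) (s s' : OnePoint (ZMod p)) :
    ∃ g ∈ Subgroup.closure {moebiusHom (ZMod p) X, moebiusHom (ZMod p) Y}, g s = s' := by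
  by_contra! hcon
  have hdis : OnePoint.map (algebraMap (ZMod p) L) s' ∉
      orbit (extGroup L X Y) (OnePoint.map (algebraMap (ZMod p) L) s) := by
    intro h
    obtain ⟨A, hA, h1⟩ := mem_range_map_of_mem_orbit h
    refine hcon (moebiusHom _ A) ?_ (OnePoint.map_algebraMap_injective h1)
    rw [← Set.image_pair, ← MonoidHom.map_closure]
    exact Subgroup.mem_map_of_mem _ hA
  have h1 := card_add_two_le_of_three_orbits (G := extGroup L X Y) card_fixed_le_two hdis
    (coe_notMem_orbit_map hP s) (coe_notMem_orbit_map hP s')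
  have h2 := three_le_ncard_orbit hP hx hx1 hy hE hc hn hn6
  have h3 := mul_ncard_orbit_le hE hc
  have h4 : (orbit (extGroup L X Y) (OnePoint.map (algebraMap (ZMod p) L) s)).ncard +
      (orbit (extGroup L X Y) (OnePoint.map (algebraMap (ZMod p) L) s')).ncard ≤ p + 1 := by
    rw [← OnePoint.ncard_range_map (p := p) (L := L),
      ← Set.ncard_union_eq _ (Set.toFinite _) (Set.toFinite _)]
    · exact Set.ncard_le_ncard (Set.union_subset (orbit_map_subset_range s)
        (orbit_map_subset_range s')) (Set.toFinite _)
    · rw [Set.disjoint_left]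
      intro Q hQ hQ'
      exact hdis (by rw [← orbit_eq_iff.2 hQ, orbit_eq_iff.2 hQ']; exact mem_orbit_self _)
  nlinarith

/-- Without parabolic elements every nontrivial discriminant is a nonzero square in L, so every
element has at least two fixed points there. Orbit counting then makes the orbit of P so small that
(YX)⁶, which is nontrivial for n ≥ 7, fixes at least three points. -/
theorem exists_isParabolic (hp : 3 < p) (hL : Fintype.card L = p ^ 2)
    (hdX : X.val.det = 1) (hdY : Y.val.det = 1)
    (hP : P ∉ Set.range (algebraMap (ZMod p) L))
    (hx : moebiusHom (ZMod p) X ^ 2 = 1) (hx1 : moebiusHom (ZMod p) X ≠ 1)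
    (hy : moebiusHom (ZMod p) Y ^ 3 = 1) (hE : IsEigenpoint (Y * X) P ζ)
    (hc : IsSemiregularOfOrder (moebiusHom (ZMod p) (Y * X)) n) (hn : 7 ≤ n)
    (hnp : 2 * n = p + 1) : ∃ A ∈ Subgroup.closure {X, Y}, A.val.IsParabolic := by
  classical
  by_contra! hcon
  have hfix : ∀ g : extGroup L X Y,
      2 ≤ (Finset.univ.filter fun Q : OnePoint L => g • Q = Q).card := by
    rintro ⟨_, A, hA, rfl⟩
    have hdA : A.val.det = 1 := det_eq_one_of_mem_closure (by simp [hdX, hdY]) hA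
    by_cases hs : A.val ∈ Set.range (scalar (Fin 2))
    · rw [← moebiusHom_eq_one_iff_scalar, ← moebiusExt_eq_one_iff (L := L)] at hs
      have : (⟨moebiusExt (ZMod p) L A, moebiusExt_mem_extGroup hA⟩ : extGroup L X Y) = 1 :=
        Subtype.ext hs
      rw [this]
      simp only [one_smul, Finset.filter_true, Finset.card_univ]
      have : Fintype.card (OnePoint L) = Fintype.card L + 1 := Fintype.card_option
      rw [this, hL]
      nlinarith
    · have hdisc : A.val.trace ^ 2 - 4 ≠ 0 := by
        intro h
        refine hcon A hA ⟨hs, ?_⟩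
        rw [discr_fin_two, hdA, mul_one, h]
      obtain ⟨d, hd⟩ := isSquare_algebraMap (L := L) hp hL (A.val.trace ^ 2 - 4)
      have hd0 : d ≠ 0 := by
        rintro rfl
        rw [mul_zero, map_eq_zero] at hd
        exact hdisc hd
      obtain ⟨Q, R, hQR, hQ, hR⟩ := exists_two_fixed_points
        (A := GeneralLinearGroup.map (algebraMap (ZMod p) L) A) (two_ne_zero_of_algebra hp) hd0 (by
          rw [det_fin_two] at hdA ⊢
          rw [trace_fin_two] at hd ⊢
          replace hdA := congrArg (algebraMap (ZMod p) L) hdA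
          simp only [map_sub, map_mul, map_add, map_pow, map_one, map_ofNat,
            GeneralLinearGroup.map_apply] at hd hdA ⊢
          linear_combination hd - 4 * hdA)
      refine (Finset.card_pair hQR).symm.le.trans (Finset.card_le_card ?_)
      intro T hT
      rw [Finset.mem_insert, Finset.mem_singleton] at hT
      rw [Finset.mem_filter]
      refine ⟨Finset.mem_univ _, ?_⟩
      rcases hT with rfl | rfl
      · exact hQ
      · exact hR
  have h2 := three_le_ncard_orbit hP hx hx1 hy hE hc (by omega) (by omega)
  have h3 := mul_ncard_orbit_le hE hc
  have hdis := coe_notMem_orbit_map (X := X) (Y := Y) hP OnePoint.infty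
  obtain ⟨P₃, h13, h23, hs⟩ := exists_stabilizer_of_two_orbits (G := extGroup L X Y) hfix hdis
    (by omega)
  have h1 := card_add_two_le_of_three_orbits (G := extGroup L X Y) card_fixed_le_two hdis h13 h23
  have h5 := ncard_orbit_mul_card_stabilizer (G := extGroup L X Y) P₃
  have h4 : (orbit (extGroup L X Y)
      (OnePoint.map (algebraMap (ZMod p) L) OnePoint.infty)).ncard ≤ p + 1 := by
    rw [← OnePoint.ncard_range_map (p := p) (L := L)]
    exact Set.ncard_le_ncard (orbit_map_subset_range _) (Set.toFinite _)
  -- For an orbit of size j, nj ≤ |G| and |G|/2 + 2 ≤ 2n + j give (n − 2)(j − 4) ≤ 4, impossible for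
  -- n ≥ 7 and j ≥ 5.
  have hj : (orbit (extGroup L X Y) (P : OnePoint L)).ncard ≤ 4 := by
    have h6 : 2 * (orbit (extGroup L X Y) P₃).ncard ≤ Nat.card (extGroup L X Y) := by nlinarith
    by_contra! h7
    nlinarith
  set e := moebiusExt (ZMod p) L (Y * X) with he
  have heP : e P = P := hE.moebiusExt_fix
  have hemem : ∀ (i : ℕ) {Q}, Q ∈ orbit (extGroup L X Y) (P : OnePoint L) →
      (e ^ i) Q ∈ orbit (extGroup L X Y) (P : OnePoint L) := by
    intro i Q hQ
    rw [he, ← map_pow]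
    exact apply_mem_orbit_extGroup
      (pow_mem (mul_mem right_mem_closure_pair left_mem_closure_pair) i) hQ
  -- YX fixes P and permutes the at most three other points of the orbit, in cycles of length 1, 2
  -- or 3, all divisors of 6.
  have he6 : ∀ Q ∈ orbit (extGroup L X Y) (P : OnePoint L), (e ^ 6) Q = Q := by
    intro Q hQ
    have hPi : ∀ i : ℕ, (e ^ i) P = P := fun i => by
      induction i with
      | zero => rfl
      | succ i ih => rw [pow_succ, Equiv.Perm.mul_apply, heP, ih]
    by_cases hQP : Q = P
    · rw [hQP, hPi]
    have hmaps : ∀ i ∈ Finset.range 4, (e ^ i) Q ∈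
        (orbit (extGroup L X Y) (P : OnePoint L) \ {(P : OnePoint L)}).toFinset := by
      intro i _
      rw [Set.mem_toFinset]
      refine ⟨hemem i hQ, fun h => hQP ?_⟩
      exact (e ^ i).injective (Eq.trans h (hPi i).symm)
    have hlt : (orbit (extGroup L X Y) (P : OnePoint L) \ {(P : OnePoint L)}).toFinset.card <
        (Finset.range 4).card := by
      rw [← Set.ncard_eq_toFinset_card', Finset.card_range,
        Set.ncard_sdiff_singleton_of_mem (mem_orbit_self _)]
      omega
    obtain ⟨i, hi, j, hj, hij, heq⟩ := Finset.exists_ne_map_eq_of_card_lt_of_maps_to hlt hmaps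
    rw [Finset.mem_range] at hi hj
    have key : ∀ {i j : ℕ}, i < j → j < 4 → (e ^ i) Q = (e ^ j) Q → (e ^ 6) Q = Q := by
      intro i j hij hj h
      obtain ⟨k, rfl⟩ := Nat.exists_eq_add_of_lt hij
      rw [add_assoc, pow_add, Equiv.Perm.mul_apply] at h
      have hk : (e ^ (k + 1)) Q = Q := ((e ^ i).injective h).symm
      have hk3 : k + 1 ∣ 6 := by
        have : k < 3 := by omega
        interval_cases k <;> decide
      obtain ⟨m, hm⟩ := hk3
      rw [hm, pow_mul]
      clear hm
      induction m with
      | zero => rfl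
      | succ m ih => rw [pow_succ, Equiv.Perm.mul_apply, hk, ih]
    rcases lt_or_gt_of_ne hij with h | h
    · exact key h hj heq
    · exact key h hi heq.symm
  have hne : (⟨e ^ 6, pow_mem (moebiusExt_mem_extGroup
      (mul_mem right_mem_closure_pair left_mem_closure_pair)) 6⟩ : extGroup L X Y) ≠ 1 := by
    intro h
    have h7 : e ^ 6 = 1 := congrArg Subtype.val h
    rw [he, ← map_pow, moebiusExt_eq_one_iff, map_pow, hc.pow_eq_one_iff] at h7
    have := Nat.le_of_dvd (by norm_num) h7
    omega
  have h8 := card_fixed_le_two _ hne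
  have h9 : (orbit (extGroup L X Y) (P : OnePoint L)).ncard ≤ 2 := by
    rw [Set.ncard_eq_toFinset_card']
    refine (Finset.card_le_card ?_).trans h8
    intro Q hQ
    rw [Set.mem_toFinset] at hQ
    exact Finset.mem_filter.2 ⟨Finset.mem_univ _, he6 Q hQ⟩
  omega

end TriangleGroup

/-! ### Pairs of matrices are determined by their traces -/

section NormalForm

variable {K : Type*} [Field K]

/-- As X² = −1, the basis v, Xv works for any v that is not an eigenvector. One of e₁, e₂, e₁ + e₂
qualifies, since otherwise X would be scalar of trace zero. -/
theorem exists_mul_companion (h2 : (2 : K) ≠ 0) {X : Matrix (Fin 2) (Fin 2) K} (hd : X.det = 1)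
    (ht : X.trace = 0) :
    ∃ B : Matrix (Fin 2) (Fin 2) K, B.det ≠ 0 ∧ X * B = B * !![0, -1; 1, 0] := by
  have hsq : X * X = -1 := by
    rw [det_fin_two] at hd
    rw [trace_fin_two] at ht
    have h11 : X 1 1 = -X 0 0 := by linear_combination ht
    rw [h11] at hd
    ext i j
    fin_cases i <;> fin_cases j <;> simp [mul_apply, h11]
    · linear_combination -hd
    · ring
    · ring
    · linear_combination -hd
  have key : ∀ v : Fin 2 → K, v 0 * (X *ᵥ v) 1 - (X *ᵥ v) 0 * v 1 ≠ 0 →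
      ∃ B : Matrix (Fin 2) (Fin 2) K, B.det ≠ 0 ∧ X * B = B * !![0, -1; 1, 0] := by
    intro v hv
    refine ⟨!![v 0, (X *ᵥ v) 0; v 1, (X *ᵥ v) 1], by rwa [det_fin_two_of], ?_⟩
    have h1 : X *ᵥ (X *ᵥ v) = -v := by rw [mulVec_mulVec, hsq, neg_mulVec, one_mulVec]
    have h10 := congrFun h1 0
    have h11 := congrFun h1 1
    simp only [mulVec_fin_two, cons_val_zero, cons_val_one, Pi.neg_apply] at h10 h11
    ext i j
    fin_cases i <;> fin_cases j <;> simp [mul_apply]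
    · linear_combination h10
    · linear_combination h11
  by_cases h10 : X 1 0 = 0
  · by_cases h01 : X 0 1 = 0
    · refine key ![1, 1] ?_
      rw [det_fin_two, h10, h01] at hd
      rw [trace_fin_two] at ht
      simp only [mulVec_fin_two, cons_val_zero, cons_val_one, h10, h01]
      intro h
      have h3 : 2 * X 0 0 = 0 := by linear_combination ht - h
      have h4 := (mul_eq_zero.1 h3).resolve_left h2
      rw [h4] at hd
      simp at hd
    · exact key ![0, 1] (by simpa using h01)
  · exact key ![1, 0] (by simpa using h10)

/-- The normal form of a matrix of order three, given a suitable involution. -/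
def tripleMatrix (r a b : K) : Matrix (Fin 2) (Fin 2) K :=
  !![1 / 2 + a, r / 2 + b; -(r / 2) + b, 1 / 2 - a]

theorem det_tripleMatrix (h2 : (2 : K) ≠ 0) (r a b : K) :
    4 * (tripleMatrix r a b).det = 1 + r ^ 2 - 4 * (a ^ 2 + b ^ 2) := by
  rw [tripleMatrix, det_fin_two_of]
  field_simp
  ring

/-- Once X is a quarter turn, tr Y gives the scalar part of Y and tr(YX) its antisymmetric part. The
symmetric traceless part (a, b) is free except for its norm, which det Y = 1 prescribes. -/
theorem exists_normal_form (h2 : (2 : K) ≠ 0) {X Y : Matrix (Fin 2) (Fin 2) K} (hX : X.det = 1)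
    (hY : Y.det = 1) (htX : X.trace = 0) (htY : Y.trace = 1) :
    ∃ (B : Matrix (Fin 2) (Fin 2) K) (a b : K), B.det ≠ 0 ∧ X * B = B * !![0, -1; 1, 0] ∧
      Y * B = B * tripleMatrix (Y * X).trace a b ∧
      4 * (a ^ 2 + b ^ 2) = (Y * X).trace ^ 2 - 3 := by
  obtain ⟨B, hB, hXB⟩ := exists_mul_companion h2 hX htX
  have hBu : IsUnit B.det := isUnit_iff_ne_zero.2 hB
  set Z := B⁻¹ * Y * B with hZ
  have hYB : Y * B = B * Z := by
    rw [hZ, mul_assoc, mul_nonsing_inv_cancel_left _ _ hBu]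
  have hZt : Z.trace = 1 := by
    rw [hZ, mul_assoc, trace_mul_comm, mul_assoc, mul_nonsing_inv _ hBu, mul_one, htY]
  have hZd : Z.det = 1 := by
    rw [hZ, det_mul, det_mul, hY, mul_one, ← det_mul, nonsing_inv_mul _ hBu, det_one]
  have hZX : (Z * !![0, -1; 1, 0]).trace = (Y * X).trace := by
    rw [hZ, mul_assoc, ← hXB, mul_assoc, trace_mul_comm, mul_assoc, mul_assoc,
      mul_nonsing_inv _ hBu, mul_one]
  have hZX' : Z 0 1 - Z 1 0 = (Y * X).trace := by
    rw [← hZX, trace_fin_two]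
    simp [mul_apply, sub_eq_add_neg]
  rw [trace_fin_two] at hZt
  have hZe : Z = tripleMatrix (Y * X).trace (Z 0 0 - 1 / 2) ((Z 0 1 + Z 1 0) / 2) := by
    rw [← hZX', tripleMatrix]
    ext i j
    fin_cases i <;> fin_cases j <;> simp <;> field_simp
    · ring
    · ring
    · linear_combination 2 * hZt
  refine ⟨B, Z 0 0 - 1 / 2, (Z 0 1 + Z 1 0) / 2, hB, hXB, ?_, ?_⟩
  · rw [← hZe, hYB]
  · have h := det_tripleMatrix h2 (Y * X).trace (Z 0 0 - 1 / 2) ((Z 0 1 + Z 1 0) / 2)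
    rw [← hZe, hZd] at h
    linear_combination h

/-- Write α = a + ib with a formal i. Multiplication by z = u + iv commutes with the quarter turn,
and conjugation by it multiplies α by z/z̄. The half-angle choice z = ᾱ(α + α') turns α into α'; it
vanishes for α' = −α, where the quarter turn itself serves. -/
theorem exists_rotation (h2 : (2 : K) ≠ 0) {r a b a' b' : K} (h : a ^ 2 + b ^ 2 = a' ^ 2 + b' ^ 2)
    (h0 : a ^ 2 + b ^ 2 ≠ 0) : ∃ R : Matrix (Fin 2) (Fin 2) K, R.det ≠ 0 ∧
      R * !![0, -1; 1, 0] = !![0, -1; 1, 0] * R ∧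
      R * tripleMatrix r a b = tripleMatrix r a' b' * R := by
  by_cases hs : a' = -a ∧ b' = -b
  · obtain ⟨rfl, rfl⟩ := hs
    refine ⟨!![0, -1; 1, 0], by simp, rfl, ?_⟩
    rw [tripleMatrix, tripleMatrix]
    ext i j
    fin_cases i <;> fin_cases j <;> simp [mul_apply] <;> ring
  · set u := a' * a + b' * b + (a ^ 2 + b ^ 2) with hu
    set v := b' * a - a' * b with hv
    have huv : u ^ 2 + v ^ 2 = 2 * (a ^ 2 + b ^ 2) * u := by
      rw [hu, hv]; linear_combination (-(a ^ 2 + b ^ 2)) * h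
    refine ⟨!![u, -v; v, u], ?_, ?_, ?_⟩
    · rw [det_fin_two_of]
      intro hd
      have h3 : 2 * (a ^ 2 + b ^ 2) * u = 0 := by rw [← huv]; linear_combination hd
      have hu0 := (mul_eq_zero.1 h3).resolve_left (mul_ne_zero h2 h0)
      rw [hu0] at hd
      have hv0 : v = 0 := by
        rw [← sq_eq_zero_iff]; linear_combination hd
      rw [hu] at hu0
      rw [hv] at hv0
      have h4 : (a ^ 2 + b ^ 2) * (a' + a) = 0 := by linear_combination a * hu0 - b * hv0
      have h5 : (a ^ 2 + b ^ 2) * (b' + b) = 0 := by linear_combination b * hu0 + a * hv0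
      refine hs ⟨?_, ?_⟩
      · exact eq_neg_of_add_eq_zero_left ((mul_eq_zero.1 h4).resolve_left h0)
      · exact eq_neg_of_add_eq_zero_left ((mul_eq_zero.1 h5).resolve_left h0)
    · ext i j
      fin_cases i <;> fin_cases j <;> simp [mul_apply]
    · rw [tripleMatrix, tripleMatrix, hu, hv]
      ext i j
      fin_cases i <;> fin_cases j <;> simp [mul_apply]
      · linear_combination a * h
      · linear_combination b * h
      · linear_combination b * h
      · linear_combination -a * h

/-- Two pairs of matrices of determinant one with the same traces are simultaneously conjugate. -/
theorem exists_conj_of_trace_eq (h2 : (2 : K) ≠ 0) {X Y X' Y' : Matrix (Fin 2) (Fin 2) K}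
    (hX : X.det = 1) (hY : Y.det = 1) (htX : X.trace = 0) (htY : Y.trace = 1)
    (hX' : X'.det = 1) (hY' : Y'.det = 1) (htX' : X'.trace = 0) (htY' : Y'.trace = 1)
    (hr : (Y * X).trace = (Y' * X').trace) (h3 : (Y * X).trace ^ 2 ≠ 3) :
    ∃ E : GL (Fin 2) K, E.val * X = X' * E.val ∧ E.val * Y = Y' * E.val := by
  obtain ⟨B, a, b, hB, hXB, hYB, hab⟩ := exists_normal_form h2 hX hY htX htY
  obtain ⟨B', a', b', hB', hXB', hYB', hab'⟩ := exists_normal_form h2 hX' hY' htX' htY'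
  have h4 : (4 : K) ≠ 0 := by
    rw [show (4 : K) = 2 * 2 by norm_num]; exact mul_ne_zero h2 h2
  have h : a ^ 2 + b ^ 2 = a' ^ 2 + b' ^ 2 := by
    apply mul_left_cancel₀ h4
    rw [hab, hab', hr]
  have h0 : a ^ 2 + b ^ 2 ≠ 0 := by
    intro h0
    rw [h0, mul_zero] at hab
    exact h3 (sub_eq_zero.1 hab.symm)
  obtain ⟨R, hR, hRX, hRY⟩ := exists_rotation (r := (Y * X).trace) h2 h h0
  have hBu : IsUnit B.det := isUnit_iff_ne_zero.2 hB
  have key : ∀ {Z Z' T T' : Matrix (Fin 2) (Fin 2) K}, Z * B = B * T → Z' * B' = B' * T' →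
      R * T = T' * R → B' * R * B⁻¹ * Z = Z' * (B' * R * B⁻¹) := by
    intro Z Z' T T' h1 h2 h3
    calc B' * R * B⁻¹ * Z = B' * R * B⁻¹ * (Z * B * B⁻¹) := by
          rw [mul_nonsing_inv_cancel_right _ _ hBu]
      _ = B' * R * (B⁻¹ * (B * T)) * B⁻¹ := by rw [h1]; simp only [mul_assoc]
      _ = B' * (R * T) * B⁻¹ := by rw [nonsing_inv_mul_cancel_left _ _ hBu]; simp only [mul_assoc]
      _ = (B' * T') * R * B⁻¹ := by rw [h3]; simp only [mul_assoc]
      _ = Z' * (B' * R * B⁻¹) := by rw [← h2]; simp only [mul_assoc]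
  have hdet : (B' * R * B⁻¹).det ≠ 0 := by
    rw [det_mul, det_mul, det_nonsing_inv, Ring.inverse_eq_inv']
    exact mul_ne_zero (mul_ne_zero hB' hR) (inv_ne_zero hB)
  refine ⟨GeneralLinearGroup.mkOfDetNeZero _ hdet, key hXB hXB' hRX, key hYB hYB' ?_⟩
  rw [hRY, hr]

end NormalForm

/-! ### Elements of order two and three in terms of traces -/

section OrderTraces

variable {K : Type*} [Field K] [DecidableEq K]

theorem trace_eq_zero_of_sq {X : GL (Fin 2) K}
    (hx : moebiusHom K X ^ 2 = 1) (hx1 : moebiusHom K X ≠ 1) : X.val.trace = 0 := by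
  by_contra ht
  rw [trace_fin_two] at ht
  rw [← map_pow, moebiusHom_eq_one_iff, Units.val_pow_eq_pow_val, sq] at hx
  simp only [mul_apply, Fin.sum_univ_two] at hx
  obtain ⟨h1, h2, h3⟩ := hx
  refine hx1 (moebiusHom_eq_one_iff.2 ⟨?_, ?_, ?_⟩)
  · exact (mul_eq_zero.1 (show (X 0 0 + X 1 1) * X 0 1 = 0 by
      linear_combination h1)).resolve_left ht
  · exact (mul_eq_zero.1 (show (X 0 0 + X 1 1) * X 1 0 = 0 by
      linear_combination h2)).resolve_left ht
  · exact sub_eq_zero.1 ((mul_eq_zero.1 (show (X 0 0 + X 1 1) * (X 0 0 - X 1 1) = 0 by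
      linear_combination h3)).resolve_left ht)

/-- By Cayley–Hamilton Y³ = (t² − 1)Y − t with t = tr Y, so a scalar cube forces t² = 1 or Y scalar.
-/
theorem trace_sq_eq_one_of_cube {Y : GL (Fin 2) K} (hY : Y.val.det = 1)
    (hy : moebiusHom K Y ^ 3 = 1) (hy1 : moebiusHom K Y ≠ 1) : Y.val.trace ^ 2 = 1 := by
  by_contra ht
  rw [trace_fin_two, ← sub_eq_zero] at ht
  rw [det_fin_two] at hY
  rw [← map_pow, moebiusHom_eq_one_iff, Units.val_pow_eq_pow_val, pow_succ, sq] at hy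
  simp only [mul_apply, Fin.sum_univ_two] at hy
  obtain ⟨h1, h2, h3⟩ := hy
  refine hy1 (moebiusHom_eq_one_iff.2 ⟨?_, ?_, ?_⟩)
  · exact (mul_eq_zero.1 (show ((Y 0 0 + Y 1 1) ^ 2 - 1) * Y 0 1 = 0 by
      linear_combination h1 + Y 0 1 * hY)).resolve_left ht
  · exact (mul_eq_zero.1 (show ((Y 0 0 + Y 1 1) ^ 2 - 1) * Y 1 0 = 0 by
      linear_combination h2 + Y 1 0 * hY)).resolve_left ht
  · exact sub_eq_zero.1 ((mul_eq_zero.1 (show ((Y 0 0 + Y 1 1) ^ 2 - 1) * (Y 0 0 - Y 1 1) = 0 by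
      linear_combination h3 + (Y 0 0 - Y 1 1) * hY)).resolve_left ht)

theorem moebiusHom_sq_of_trace {X : GL (Fin 2) K} (ht : X.val.trace = 0) :
    moebiusHom K X ^ 2 = 1 := by
  rw [trace_fin_two] at ht
  rw [← map_pow, moebiusHom_eq_one_iff, Units.val_pow_eq_pow_val, sq]
  simp only [mul_apply, Fin.sum_univ_two]
  refine ⟨?_, ?_, ?_⟩
  · linear_combination X 0 1 * ht
  · linear_combination X 1 0 * ht
  · linear_combination (X 0 0 - X 1 1) * ht

theorem moebiusHom_cube_of_trace {Y : GL (Fin 2) K} (hY : Y.val.det = 1)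
    (ht : Y.val.trace = 1) : moebiusHom K Y ^ 3 = 1 := by
  rw [trace_fin_two] at ht
  rw [det_fin_two] at hY
  rw [← map_pow, moebiusHom_eq_one_iff, Units.val_pow_eq_pow_val, pow_succ, sq]
  simp only [mul_apply, Fin.sum_univ_two]
  refine ⟨?_, ?_, ?_⟩
  · linear_combination (Y 0 0 + Y 1 1 + 1) * Y 0 1 * ht - Y 0 1 * hY
  · linear_combination (Y 0 0 + Y 1 1 + 1) * Y 1 0 * ht - Y 1 0 * hY
  · linear_combination (Y 0 0 + Y 1 1 + 1) * (Y 0 0 - Y 1 1) * ht - (Y 0 0 - Y 1 1) * hY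

theorem moebiusHom_ne_one_of_trace (h2 : (2 : K) ≠ 0) {X : GL (Fin 2) K} (hX : X.val.trace = 0) :
    moebiusHom K X ≠ 1 := by
  intro h
  obtain ⟨h1, h3, h4⟩ := moebiusHom_eq_one_iff.1 h
  rw [trace_fin_two, h4] at hX
  have h5 : X 1 1 = 0 := (mul_eq_zero.1 (show 2 * X 1 1 = 0 by
    linear_combination hX)).resolve_left h2
  apply X.det_ne_zero
  rw [det_fin_two, h1, h5]
  ring

end OrderTraces

/-! ### Bijections conjugating a parabolic element are Möbius transformations -/

section Rigidity

theorem exists_conj_translation {K : Type*} [Field K] [DecidableEq K] (h2 : (2 : K) ≠ 0)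
    {A : GL (Fin 2) K} (hA : A.IsParabolic) :
    ∃ E : GL (Fin 2) K, moebiusHom K A =
      moebiusHom K E * moebiusHom K (GeneralLinearGroup.upperRightHom 1) * (moebiusHom K E)⁻¹ := by
  have : NeZero (2 : K) := ⟨h2⟩
  obtain ⟨a, N, hAN, hN0, hN2⟩ := isParabolic_iff_exists.1 hA
  have ha : a ≠ 0 := by
    rintro rfl
    apply A.det_ne_zero
    rw [map_zero, zero_add] at hAN
    rw [← sq_eq_zero_iff, ← det_pow, hAN, hN2, det_zero]
  rw [sq] at hN2
  have h00 := congrFun (congrFun hN2 0) 0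
  have h01 := congrFun (congrFun hN2 0) 1
  have h10 := congrFun (congrFun hN2 1) 0
  have h11 := congrFun (congrFun hN2 1) 1
  simp only [mul_apply, Fin.sum_univ_two, Matrix.zero_apply] at h00 h01 h10 h11
  -- The columns of B are Ne/a and e for a standard basis vector e with Ne ≠ 0: A scales the first
  -- by a and sends e to a(e + Ne/a).
  obtain ⟨B, hB, hAB⟩ : ∃ B : Matrix (Fin 2) (Fin 2) K, B.det ≠ 0 ∧
      A.val * B = a • (B * !![1, 1; 0, 1]) := by
    by_cases hN : N 1 0 = 0
    · have hN01 : N 0 1 ≠ 0 := by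
        intro h
        apply hN0
        rw [hN, h] at h00 h11
        ext i j
        fin_cases i <;> fin_cases j
        · simpa using h00
        · exact h
        · exact hN
        · simpa using h11
      have htr := (mul_eq_zero.1 (show (N 0 0 + N 1 1) * N 0 1 = 0 by
        linear_combination h01)).resolve_right hN01
      refine ⟨!![N 0 1 / a, 0; N 1 1 / a, 1], ?_, ?_⟩
      · rw [det_fin_two_of]
        simp [hN01, ha]
      · rw [hAN]
        ext i j
        fin_cases i <;> fin_cases j <;> simp [mul_apply] <;> field_simp
        · linear_combination htr
        · linear_combination h11
        · ring
    · have htr := (mul_eq_zero.1 (show (N 0 0 + N 1 1) * N 1 0 = 0 by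
        linear_combination h10)).resolve_right hN
      refine ⟨!![N 0 0 / a, 1; N 1 0 / a, 0], ?_, ?_⟩
      · rw [det_fin_two_of]
        simp [hN, ha]
      · rw [hAN]
        ext i j
        fin_cases i <;> fin_cases j <;> simp [mul_apply] <;> field_simp
        · linear_combination h00
        · ring
        · linear_combination htr
  refine ⟨GeneralLinearGroup.mkOfDetNeZero B hB, ?_⟩
  rw [eq_mul_inv_iff_mul_eq, ← map_mul, ← map_mul, moebiusHom_eq_iff]
  exact ⟨a, hAB⟩

variable {p : ℕ} [Fact p.Prime]

theorem translation_apply (b c : ZMod p) :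
    moebiusHom (ZMod p) (GeneralLinearGroup.upperRightHom b) (c : OnePoint (ZMod p)) =
      ((c + b : ZMod p) : OnePoint (ZMod p)) := by
  change (GeneralLinearGroup.upperRightHom b) • (c : OnePoint (ZMod p)) = _
  rw [OnePoint.smul_some_eq_ite]
  simp

theorem translation_infty (b : ZMod p) :
    moebiusHom (ZMod p) (GeneralLinearGroup.upperRightHom b) OnePoint.infty = OnePoint.infty := by
  change (GeneralLinearGroup.upperRightHom b) • (OnePoint.infty : OnePoint (ZMod p)) = _
  rw [OnePoint.smul_infty_eq_self_iff]
  simp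

/-- The only fixed point ∞ of z ↦ z + 1 is preserved, and 1 generates F_p additively, so e is the
translation by e(0). -/
theorem mem_moebiusPGL_of_commute_translation {e : Equiv.Perm (OnePoint (ZMod p))}
    (h : ∀ z, e (moebiusHom (ZMod p) (GeneralLinearGroup.upperRightHom 1) z) =
      moebiusHom (ZMod p) (GeneralLinearGroup.upperRightHom 1) (e z)) :
    e ∈ moebiusPGL (ZMod p) := by
  have hinf : e OnePoint.infty = OnePoint.infty := by
    cases he : e OnePoint.infty with
    | infty => rfl
    | coe c =>
      have h1 := h OnePoint.infty
      rw [translation_infty, he, translation_apply, OnePoint.coe_eq_coe] at h1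
      simp at h1
  cases h0 : e ((0 : ZMod p) : OnePoint (ZMod p)) with
  | infty =>
    have := e.injective (h0.trans hinf.symm)
    exact absurd this (OnePoint.coe_ne_infty _)
  | coe b =>
    have hk : ∀ k : ℕ, e (((k : ZMod p) : ZMod p) : OnePoint (ZMod p)) =
        (((k : ZMod p) + b : ZMod p) : OnePoint (ZMod p)) := by
      intro k
      induction k with
      | zero => simpa using h0
      | succ k ih =>
        have h1 := h (((k : ZMod p) : ZMod p) : OnePoint (ZMod p))
        rw [translation_apply, ih, translation_apply] at h1
        rw [Nat.cast_succ, h1]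
        congr 1
        ring
    refine ⟨GeneralLinearGroup.upperRightHom b, ?_⟩
    ext z
    cases z with
    | infty => rw [hinf]; exact translation_infty b
    | coe z =>
      have := hk z.val
      rw [ZMod.natCast_zmod_val] at this
      rw [this]
      exact translation_apply b z

/-- If A^p is the scalar u, then u² = 1 by determinants and tr A = (tr A)^p = tr(A^p) = 2u, so the
discriminant vanishes. -/
theorem isParabolic_of_pow_eq_one {A : GL (Fin 2) (ZMod p)} (hd : A.val.det = 1)
    (h1 : moebiusHom (ZMod p) A ≠ 1) (hpow : moebiusHom (ZMod p) A ^ p = 1) : A.IsParabolic := by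
  refine ⟨fun h => h1 (moebiusHom_eq_one_iff_scalar.2 h), ?_⟩
  rw [← map_pow, moebiusHom_eq_one_iff_scalar, Units.val_pow_eq_pow_val] at hpow
  obtain ⟨u, hu⟩ := hpow
  have hdet := congrArg det hu
  rw [det_pow, hd, one_pow] at hdet
  have htr := congrArg trace hu
  rw [ZMod.trace_pow_card, ZMod.pow_card] at htr
  simp only [scalar_apply, det_diagonal, trace_diagonal, Fin.prod_univ_two, Fin.sum_univ_two]
    at hdet htr
  rw [discr_fin_two, hd, ← htr]
  linear_combination 4 * hdet

/-- A bijection of the projective line over `ZMod p` that conjugates a parabolic Möbius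
transformation to an element of `PSL` is a Möbius transformation. -/
theorem mem_moebiusPGL_of_conj_parabolic (hp : 3 < p) {A : GL (Fin 2) (ZMod p)}
    (hA : A.IsParabolic) {e g : Equiv.Perm (OnePoint (ZMod p))} (hg : g ∈ moebiusPSL (ZMod p))
    (h : e * moebiusHom (ZMod p) A = g * e) : e ∈ moebiusPGL (ZMod p) := by
  have h2 : (2 : ZMod p) ≠ 0 := two_ne_zero_of_algebra hp
  obtain ⟨A', hdA', rfl⟩ := mem_moebiusPSL_iff.1 hg
  obtain ⟨E, hE⟩ := exists_conj_translation h2 hA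
  set t := moebiusHom (ZMod p) (GeneralLinearGroup.upperRightHom 1) with ht
  have htp : t ^ p = 1 := by
    have : (GeneralLinearGroup.upperRightHom (1 : ZMod p)) ^ p = 1 := by
      rw [← AddChar.map_nsmul_eq_pow]; simp
    rw [ht, ← map_pow, this, map_one]
  have hgA : moebiusHom (ZMod p) A' = e * moebiusHom (ZMod p) A * e⁻¹ := by
    rw [h, mul_inv_cancel_right]
  have hA' : A'.IsParabolic := by
    refine isParabolic_of_pow_eq_one hdA' ?_ ?_
    · intro h1
      rw [h1, eq_comm, conj_eq_one_iff] at hgA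
      exact hA.1 (moebiusHom_eq_one_iff_scalar.1 hgA)
    · rw [hgA, conj_pow, hE, conj_pow, htp]
      group
  obtain ⟨E', hE'⟩ := exists_conj_translation h2 hA'
  rw [← ht] at hE'
  -- Both parabolic maps are Möbius conjugates of z ↦ z + 1; corrected by the two conjugators, e
  -- commutes with this translation.
  have hcomm : (moebiusHom (ZMod p) E')⁻¹ * e * moebiusHom (ZMod p) E * t =
      t * ((moebiusHom (ZMod p) E')⁻¹ * e * moebiusHom (ZMod p) E) := by
    rw [hE, hE'] at h
    calc _ = (moebiusHom (ZMod p) E')⁻¹ * (e * (moebiusHom (ZMod p) E * t *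
          (moebiusHom (ZMod p) E)⁻¹)) * moebiusHom (ZMod p) E := by group
      _ = _ := by rw [h]; group
  have hmem := mem_moebiusPGL_of_commute_translation
    (e := (moebiusHom (ZMod p) E')⁻¹ * e * moebiusHom (ZMod p) E)
    (fun z => congrArg (fun f => f z) hcomm)
  have := mul_mem (mul_mem (show moebiusHom (ZMod p) E' ∈ moebiusPGL (ZMod p) from ⟨E', rfl⟩) hmem)
    (inv_mem (show moebiusHom (ZMod p) E ∈ moebiusPGL (ZMod p) from ⟨E, rfl⟩))
  have heq : e = moebiusHom (ZMod p) E' * ((moebiusHom (ZMod p) E')⁻¹ * e * moebiusHom (ZMod p) E) *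
      (moebiusHom (ZMod p) E)⁻¹ := by group
  rwa [heq]

end Rigidity

/-! ### The face condition as semiregularity -/

section Semiregular

variable {S : Type*} [Finite S]

theorem ncard_orbit_zpowers (c : Equiv.Perm S) (z : S) :
    (orbit (Subgroup.zpowers c) z).ncard = Function.minimalPeriod (c • · : S → S) z := by
  have := Fintype.ofFinite (orbit (Subgroup.zpowers c) z)
  rw [minimalPeriod_eq_card (a := c) (b := z), ← Nat.card_coe_set_eq, Nat.card_eq_fintype_card]

theorem isSemiregularOfOrder_iff {c : Equiv.Perm S} {n : ℕ} :
    IsSemiregularOfOrder c n ↔ ∀ z : S, (orbit (Subgroup.zpowers c) z).ncard = n := by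
  have h : ∀ (i : ℕ) (z : S), (c ^ i) z = z ↔ Function.minimalPeriod (c • · : S → S) z ∣ i :=
    fun i z => pow_smul_eq_iff_minimalPeriod_dvd (a := c) (b := z)
  simp_rw [ncard_orbit_zpowers]
  constructor
  · intro hc z
    exact Nat.dvd_antisymm ((h n z).1 ((hc n z).2 dvd_rfl)) ((hc _ z).1 ((h _ z).2 dvd_rfl))
  · intro hc i z
    rw [h, hc]

theorem IsSemiregularOfOrder.card_quotient_mul {c : Equiv.Perm S} {n : ℕ}
    (h : IsSemiregularOfOrder c n) :
    Nat.card (orbitRel.Quotient (Subgroup.zpowers c) S) * n = Nat.card S := by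
  classical
  have := Fintype.ofFinite (orbitRel.Quotient (Subgroup.zpowers c) S)
  rw [Nat.card_congr (selfEquivSigmaOrbits (Subgroup.zpowers c) S), Nat.card_sigma]
  simp_rw [Nat.card_coe_set_eq, isSemiregularOfOrder_iff.1 h]
  rw [Finset.sum_const, Finset.card_univ, Nat.card_eq_fintype_card, smul_eq_mul]

theorem Januarial.isSemiregular {k n : ℕ} (J : Januarial k S) (hn : Nat.card S = 2 * n) :
    IsSemiregularOfOrder (J.y * J.x) n := by
  rw [isSemiregularOfOrder_iff]
  intro z
  have := J.face_size z
  omega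

/-- If x = 1, the group ⟨xy⟩ = ⟨y⟩ would be transitive and there would be one face only. -/
theorem Januarial.x_ne_one [Nonempty S] {k : ℕ} (J : Januarial k S) : J.x ≠ 1 := by
  intro hx
  have h1 := J.face_size (Classical.arbitrary S)
  have h2 : orbit (Subgroup.zpowers (J.y * J.x)) (Classical.arbitrary S) = Set.univ := by
    rw [Set.eq_univ_iff_forall]
    intro s
    obtain ⟨g, hg, hgs⟩ := J.transitive (Classical.arbitrary S) s
    rw [hx, Subgroup.closure_insert_one, ← Subgroup.zpowers_eq_closure] at hg
    rw [hx, mul_one]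
    exact ⟨⟨g, hg⟩, hgs⟩
  rw [h2, Set.ncard_univ] at h1
  have : 0 < Nat.card S := Nat.card_pos
  omega

end Semiregular

/-! ### Counting the possible squared traces -/

section RootTraces

variable {L : Type*} [Field L] [DecidableEq L]

/-- The squared traces of matrices of determinant one whose squared eigenvalues have order `n`. -/
noncomputable def sqTraces (L : Type*) [Field L] [DecidableEq L] (n : ℕ) : Finset L :=
  (primitiveRoots n L).image fun w => w + w⁻¹ + 2

theorem mem_sqTraces {n : ℕ} (hn : 0 < n) {s : L} :
    s ∈ sqTraces L n ↔ ∃ w : L, IsPrimitiveRoot w n ∧ w + w⁻¹ + 2 = s := by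
  simp [sqTraces, mem_primitiveRoots hn]

theorem two_mul_card_sqTraces {n : ℕ} (hn : 3 ≤ n) {w : L} (hw : IsPrimitiveRoot w n) :
    2 * (sqTraces L n).card = n.totient := by
  -- The fibres are the pairs {v, v⁻¹}, with v ≠ v⁻¹ because v has order n ≥ 3.
  have hfib : ∀ s ∈ sqTraces L n,
      ((primitiveRoots n L).filter fun w => w + w⁻¹ + 2 = s).card = 2 := by
    intro s hs
    obtain ⟨v, hv, rfl⟩ := (mem_sqTraces (by omega)).1 hs
    have hv0 : v ≠ 0 := hv.ne_zero (by omega)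
    have hne : v ≠ v⁻¹ := by
      intro h
      have h2 : v ^ 2 = 1 := by
        rw [sq]
        nth_rewrite 2 [h]
        exact mul_inv_cancel₀ hv0
      have := Nat.le_of_dvd (by norm_num) (hv.dvd_of_pow_eq_one 2 h2)
      omega
    rw [← Finset.card_pair hne]
    congr 1
    ext u
    rw [Finset.mem_filter, mem_primitiveRoots (by omega), Finset.mem_insert,
      Finset.mem_singleton]
    constructor
    · rintro ⟨hu, huv⟩
      have hu0 : u ≠ 0 := hu.ne_zero (by omega)
      have h : (u - v) * (u - v⁻¹) = 0 := by
        field_simp at huv ⊢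
        linear_combination huv
      exact (mul_eq_zero.1 h).imp sub_eq_zero.1 sub_eq_zero.1
    · rintro (rfl | rfl)
      · exact ⟨hv, rfl⟩
      · exact ⟨hv.inv, by rw [inv_inv, add_comm v⁻¹ v]⟩
  have hsum := Finset.card_eq_sum_card_image (fun w : L => w + w⁻¹ + 2) (primitiveRoots n L)
  rw [hw.card_primitiveRoots] at hsum
  rw [hsum, mul_comm]
  exact (Finset.sum_const_nat hfib).symm

/-- The value 3 means w² − w + 1 = 0, so w³ = −1 and w⁶ = 1; hence n divides 6, and n = 3 would give
1 = −1. -/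
theorem three_notMem_sqTraces (h2 : (2 : L) ≠ 0) {n : ℕ} (hn : 3 ≤ n) (hn6 : n ≠ 6) :
    (3 : L) ∉ sqTraces L n := by
  rw [mem_sqTraces (by omega)]
  rintro ⟨w, hw, h⟩
  have hw0 : w ≠ 0 := hw.ne_zero (by omega)
  have h1 : w ^ 2 - w + 1 = 0 := by
    field_simp at h
    linear_combination h
  have h3 : w ^ 3 = -1 := by linear_combination (w + 1) * h1
  have h6 : w ^ 6 = 1 := by rw [show 6 = 3 * 2 from rfl, pow_mul, h3]; norm_num
  have hd := hw.dvd_of_pow_eq_one 6 h6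
  have := Nat.le_of_dvd (by norm_num) hd
  have hn3 : n ≠ 3 := by
    rintro rfl
    rw [hw.pow_eq_one] at h3
    exact h2 (by linear_combination h3)
  interval_cases n <;> omega

end RootTraces

/-! ### The squared trace as a complete invariant -/

section Lifts

variable {p : ℕ} [Fact p.Prime]

theorem trace_sq_eq_of_moebiusHom_eq {K : Type*} [Field K] [DecidableEq K] {A B : GL (Fin 2) K}
    (hA : A.val.det = 1) (hB : B.val.det = 1) (h : moebiusHom K A = moebiusHom K B) :
    A.val.trace ^ 2 = B.val.trace ^ 2 := by
  obtain ⟨u, hu⟩ := moebiusHom_eq_iff.1 h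
  rw [hu, det_smul, hB, Fintype.card_fin, mul_one] at hA
  rw [hu, trace_smul, smul_eq_mul, mul_pow, hA, one_mul]

/-- `X` and `Y` are normalised matrices that induce the generators of `J`. -/
structure IsLift (J : Januarial 3 (OnePoint (ZMod p))) (X Y : GL (Fin 2) (ZMod p)) : Prop where
  det_x : X.val.det = 1
  det_y : Y.val.det = 1
  trace_x : X.val.trace = 0
  trace_y : Y.val.trace = 1
  map_x : moebiusHom (ZMod p) X = J.x
  map_y : moebiusHom (ZMod p) Y = J.y

theorem moebiusHom_neg {K : Type*} [Field K] [DecidableEq K] (A : GL (Fin 2) K) :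
    moebiusHom K (-A) = moebiusHom K A :=
  moebiusHom_eq_iff.2 ⟨-1, by rw [Units.val_neg, neg_one_smul]⟩

theorem IsLift.neg_left {J : Januarial 3 (OnePoint (ZMod p))} {X Y : GL (Fin 2) (ZMod p)}
    (h : IsLift J X Y) : IsLift J (-X) Y where
  det_x := by rw [Units.val_neg, det_neg, h.det_x]; simp
  det_y := h.det_y
  trace_x := by rw [Units.val_neg, trace_neg, h.trace_x, neg_zero]
  trace_y := h.trace_y
  map_x := by rw [moebiusHom_neg, h.map_x]
  map_y := h.map_y

variable {J J' : Januarial 3 (OnePoint (ZMod p))} {X Y X' Y' : GL (Fin 2) (ZMod p)} {n : ℕ}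

theorem Januarial.isSemiregular_of_prime (J : Januarial 3 (OnePoint (ZMod p)))
    (hn : 2 * n = p + 1) : IsSemiregularOfOrder (J.y * J.x) n :=
  J.isSemiregular (by rw [OnePoint.card_zmod, hn])

/-- Order two forces trace 0 and order three forces trace ±1, where the sign of Y can be adjusted.
If y were trivial, xy would have order at most 2 < n. -/
theorem exists_isLift (hn : 2 * n = p + 1) (hn3 : 3 ≤ n) (hx : J.x ∈ moebiusPSL (ZMod p))
    (hy : J.y ∈ moebiusPSL (ZMod p)) : ∃ X Y, IsLift J X Y := by
  obtain ⟨X, hdX, hX⟩ := mem_moebiusPSL_iff.1 hx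
  obtain ⟨Y, hdY, hY⟩ := mem_moebiusPSL_iff.1 hy
  have hy1 : J.y ≠ 1 := by
    intro h
    have h1 := J.isSemiregular_of_prime hn
    have h2 := (h1.pow_eq_one_iff 2).1 (by rw [h, one_mul, J.x_sq])
    have := Nat.le_of_dvd (by norm_num) h2
    omega
  have htX := trace_eq_zero_of_sq (X := X) (by rw [hX, J.x_sq]) (by rw [hX]; exact J.x_ne_one)
  have htY := trace_sq_eq_one_of_cube hdY (by rw [hY, J.y_pow]) (by rw [hY]; exact hy1)
  rcases sq_eq_one_iff.1 htY with h | h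
  · exact ⟨X, Y, hdX, hdY, htX, h, hX, hY⟩
  · refine ⟨X, -Y, hdX, ?_, htX, ?_, hX, ?_⟩
    · rw [Units.val_neg, det_neg, hdY]; simp
    · rw [Units.val_neg, trace_neg, h, neg_neg]
    · rw [moebiusHom_neg, hY]

theorem IsLift.det_mul (h : IsLift J X Y) : (Y * X).val.det = 1 := by
  rw [Units.val_mul, Matrix.det_mul, h.det_x, h.det_y, one_mul]

theorem IsLift.isSemiregular (h : IsLift J X Y) (hn : 2 * n = p + 1) :
    IsSemiregularOfOrder (moebiusHom (ZMod p) (Y * X)) n := by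
  rw [map_mul, h.map_x, h.map_y]
  exact J.isSemiregular_of_prime hn

section

variable {L : Type*} [Field L] [Algebra (ZMod p) L] [Fintype L] [DecidableEq L]

theorem IsLift.trace_sq_mem (h : IsLift J X Y) (hp : 3 < p) (hL : Fintype.card L = p ^ 2)
    (hn : 2 * n = p + 1) : algebraMap (ZMod p) L ((Y * X).val.trace ^ 2) ∈ sqTraces L n := by
  obtain ⟨P, ζ, -, hE, hζ⟩ := (h.isSemiregular hn).exists_isEigenpoint (L := L) hp hL hn h.det_mul
  rw [mem_sqTraces (by omega)]
  refine ⟨_, hζ, ?_⟩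
  have hq := hE.quadratic h.det_mul
  have h0 := hE.ne_zero h.det_mul
  have h1 : algebraMap (ZMod p) L (Y * X).val.trace = ζ + ζ⁻¹ := by
    field_simp
    linear_combination -hq
  rw [map_pow, h1]
  field_simp
  ring

theorem IsLift.iso_of_trace_sq_eq (hp : 3 < p) (hL : Fintype.card L = p ^ 2)
    (hn : 2 * n = p + 1) (hn3 : 3 ≤ n) (hn6 : n ≠ 6) (h : IsLift J X Y) (h' : IsLift J' X' Y')
    (ht : (Y * X).val.trace ^ 2 = (Y' * X').val.trace ^ 2) : J.Iso J' := by
  have key : ∀ {X' : GL (Fin 2) (ZMod p)}, IsLift J' X' Y' →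
      (Y * X).val.trace = (Y' * X').val.trace → J.Iso J' := by
    intro X' h' ht
    have h3 : (Y.val * X.val).trace ^ 2 ≠ 3 := by
      intro h3
      have h4 := h.trace_sq_mem (L := L) hp hL hn
      rw [Units.val_mul, h3, map_ofNat] at h4
      exact three_notMem_sqTraces (two_ne_zero_of_algebra hp) hn3 hn6 h4
    obtain ⟨E, hEX, hEY⟩ := exists_conj_of_trace_eq (two_ne_zero_of_algebra hp) h.det_x h.det_y
      h.trace_x h.trace_y h'.det_x h'.det_y h'.trace_x h'.trace_y ht h3
    have hEX' := congrArg (moebiusHom (ZMod p)) (show E * X = X' * E from Units.ext hEX)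
    have hEY' := congrArg (moebiusHom (ZMod p)) (show E * Y = Y' * E from Units.ext hEY)
    rw [map_mul, map_mul, h.map_x, h'.map_x] at hEX'
    rw [map_mul, map_mul, h.map_y, h'.map_y] at hEY'
    exact ⟨moebiusHom (ZMod p) E, fun s => congrArg (fun f => f s) hEX',
      fun s => congrArg (fun f => f s) hEY'⟩
  rcases sq_eq_sq_iff_eq_or_eq_neg.1 ht with ht | ht
  · exact key h' ht
  -- Opposite traces become equal when X' is replaced by −X'.
  · exact key h'.neg_left (by rw [ht, mul_neg, Units.val_neg, trace_neg])

theorem mul_mem_closure_of_conj {S : Type*} {x y x' y' e : Equiv.Perm S} (hx : e * x = x' * e)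
    (hy : e * y = y' * e) {g : Equiv.Perm S} (hg : g ∈ Subgroup.closure {x, y}) :
    ∃ g' ∈ Subgroup.closure {x', y'}, e * g = g' * e := by
  refine ⟨e * g * e⁻¹, ?_, by group⟩
  have : (Subgroup.closure {x, y}).map (MulAut.conj e).toMonoidHom = Subgroup.closure {x', y'} := by
    have hx' : (MulAut.conj e).toMonoidHom x = x' := by simp [hx]
    have hy' : (MulAut.conj e).toMonoidHom y = y' := by simp [hy]
    rw [MonoidHom.map_closure, Set.image_pair, hx', hy']
  rw [← this]
  exact ⟨g, hg, by simp⟩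

/-- A parabolic element of the first group goes to an element of the second, which lies in PSL(2,p).
By rigidity the isomorphism is then Möbius, and conjugation preserves the squared trace. -/
theorem IsLift.trace_sq_eq_of_iso (hp : 3 < p) (hL : Fintype.card L = p ^ 2)
    (hn : 2 * n = p + 1) (hn7 : 7 ≤ n) (h : IsLift J X Y) (h' : IsLift J' X' Y')
    (hJ : J.Iso J') : (Y * X).val.trace ^ 2 = (Y' * X').val.trace ^ 2 := by
  obtain ⟨e, hx, hy⟩ := hJ
  replace hx : e * J.x = J'.x * e := Equiv.ext hx
  replace hy : e * J.y = J'.y * e := Equiv.ext hy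
  obtain ⟨P, ζ, hP, hE, hζ⟩ := (h.isSemiregular hn).exists_isEigenpoint (L := L) hp hL hn h.det_mul
  obtain ⟨A, hA, hpar⟩ := exists_isParabolic hp hL h.det_x h.det_y hP (by rw [h.map_x, J.x_sq])
    (by rw [h.map_x]; exact J.x_ne_one) (by rw [h.map_y, J.y_pow]) hE (h.isSemiregular hn) hn7 hn
  have hA' : moebiusHom (ZMod p) A ∈ Subgroup.closure {J.x, J.y} := by
    rw [← h.map_x, ← h.map_y, ← Set.image_pair, ← MonoidHom.map_closure]
    exact Subgroup.mem_map_of_mem _ hA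
  obtain ⟨g', hg', heg⟩ := mul_mem_closure_of_conj hx hy hA'
  have hPSL : Subgroup.closure {J'.x, J'.y} ≤ moebiusPSL (ZMod p) := by
    rw [Subgroup.closure_le]
    rintro g (rfl | rfl)
    · exact mem_moebiusPSL_iff.2 ⟨X', h'.det_x, h'.map_x⟩
    · exact mem_moebiusPSL_iff.2 ⟨Y', h'.det_y, h'.map_y⟩
  obtain ⟨E, rfl⟩ := mem_moebiusPGL_of_conj_parabolic hp hpar (hPSL hg') heg
  have hc : moebiusHom (ZMod p) (E * (Y * X) * E⁻¹) = moebiusHom (ZMod p) (Y' * X') := by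
    simp only [map_mul, map_inv, h.map_x, h.map_y, h'.map_x, h'.map_y]
    rw [← mul_assoc, hy, mul_assoc _ _ J.x, hx]
    group
  have htr : (E * (Y * X) * E⁻¹).val.trace = (Y * X).val.trace := by
    rw [Units.val_mul, trace_mul_comm, ← Units.val_mul, ← mul_assoc, inv_mul_cancel, one_mul]
  have hdet : (E * (Y * X) * E⁻¹).val.det = 1 := by
    rw [Units.val_mul, det_mul_comm, ← Units.val_mul, ← mul_assoc, inv_mul_cancel, one_mul,
      h.det_mul]
  rw [← htr, trace_sq_eq_of_moebiusHom_eq hdet h'.det_mul hc]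

end

end Lifts

/-! ### Construction of an associate for every value -/

section Existence

variable {p : ℕ} [Fact p.Prime] {L : Type*} [Field L] [Algebra (ZMod p) L] [Fintype L]
  {n : ℕ}

theorem exists_isPrimitiveRoot (hL : Fintype.card L = p ^ 2) (hn : 2 * n = p + 1) :
    ∃ w : L, IsPrimitiveRoot w n := by
  classical
  obtain ⟨g, hg⟩ := IsCyclic.exists_generator (α := Lˣ)
  have hord : orderOf g = p ^ 2 - 1 := by
    rw [orderOf_eq_card_of_forall_mem_zpowers hg, Nat.card_eq_fintype_card, Fintype.card_units, hL]
  have hp := (Fact.out : p.Prime).two_le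
  have hfac : p ^ 2 - 1 = 2 * (p - 1) * n := by
    obtain ⟨m, rfl⟩ : ∃ m, p = m + 1 := ⟨p - 1, by omega⟩
    have h1 : (m + 1) ^ 2 = 2 * m * n + 1 := by
      rw [mul_assoc, mul_left_comm, hn]; ring
    rw [h1]
    simp
  have hg' : IsPrimitiveRoot (g ^ (2 * (p - 1))) n := by
    refine (IsPrimitiveRoot.orderOf g).pow (orderOf_pos g) ?_
    rw [hord, hfac]
  exact ⟨_, IsPrimitiveRoot.coe_units_iff.2 hg'⟩

theorem mem_range_of_pow_eq_self {L : Type*} [Field L] [Algebra (ZMod p) L] {μ : L}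
    (h : μ ^ p = μ) :
    μ ∈ Set.range (algebraMap (ZMod p) L) := by
  have : CharP L p := charP_of_injective_algebraMap (algebraMap (ZMod p) L).injective p
  have h1 := (Subfield.mem_bot_iff_pow_eq_self (F := L) (p := p)).2 h
  exact (bot_le : (⊥ : Subfield L) ≤ (algebraMap (ZMod p) L).fieldRange) h1

/-- For w = u² one has u^(p+1) = 1, so Frobenius interchanges u and u⁻¹ and fixes their sum. -/
theorem exists_algebraMap_sq_eq (hp : 3 < p) (hL : Fintype.card L = p ^ 2)
    (hn : 2 * n = p + 1) {w : L} (hw : IsPrimitiveRoot w n) :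
    ∃ r : ZMod p, algebraMap (ZMod p) L r ^ 2 = w + w⁻¹ + 2 := by
  obtain ⟨u, hu⟩ := isSquare_of_pow_eq_one hp hL hn hw.pow_eq_one
  have hw0 : w ≠ 0 := hw.ne_zero (by omega)
  have hu0 : u ≠ 0 := by rintro rfl; simp [hu] at hw0
  have : CharP L p := charP_of_injective_algebraMap (algebraMap (ZMod p) L).injective p
  have hup : u ^ p = u⁻¹ := by
    apply eq_inv_of_mul_eq_one_left
    rw [← pow_succ, ← hn, pow_mul, sq, ← hu, hw.pow_eq_one]
  obtain ⟨r, hr⟩ := mem_range_of_pow_eq_self (p := p) (μ := u + u⁻¹) (by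
    rw [add_pow_char, inv_pow, hup, inv_inv, add_comm])
  refine ⟨r, ?_⟩
  rw [hr, hu]
  field_simp
  ring

variable [DecidableEq L]

/-- The involution inverting both matrices in normal form. -/
def reflectionMatrix {K : Type*} [Field K] (a b : K) : Matrix (Fin 2) (Fin 2) K := !![-b, a; a, b]

theorem exists_associateJanuarial (hp : 3 < p) (hL : Fintype.card L = p ^ 2)
    (hn : 2 * n = p + 1) (hn3 : 3 ≤ n) (hn6 : n ≠ 6) {s : L} (hs : s ∈ sqTraces L n) :
    ∃ J ∈ associateJanuarials p, ∃ X Y, IsLift J X Y ∧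
      algebraMap (ZMod p) L ((Y * X).val.trace ^ 2) = s := by
  have h2 : (2 : ZMod p) ≠ 0 := two_ne_zero_of_algebra hp
  have h4 : (4 : ZMod p) ≠ 0 := by
    rw [show (4 : ZMod p) = 2 * 2 by norm_num]; exact mul_ne_zero h2 h2
  obtain ⟨w, hw, rfl⟩ := (mem_sqTraces (by omega)).1 hs
  obtain ⟨r, hr⟩ := exists_algebraMap_sq_eq hp hL hn hw
  -- Every element of F_p is a sum of two squares; this one makes the determinant of `tripleMatrix`
  -- equal to 1.
  obtain ⟨a, b, hab⟩ := ZMod.sq_add_sq p ((r ^ 2 - 3) / 4)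
  rw [eq_div_iff h4] at hab
  have hab0 : a ^ 2 + b ^ 2 ≠ 0 := by
    intro h
    rw [h, zero_mul] at hab
    refine three_notMem_sqTraces (L := L) (two_ne_zero_of_algebra hp) hn3 hn6 ?_
    rw [← hr, ← map_pow, sub_eq_zero.1 hab.symm, map_ofNat] at hs
    exact hs
  have hdX : (!![0, -1; 1, 0] : Matrix (Fin 2) (Fin 2) (ZMod p)).det = 1 := by simp
  have hdY : (tripleMatrix r a b).det = 1 := by
    apply mul_left_cancel₀ h4
    rw [det_tripleMatrix h2]
    linear_combination -hab
  have hdT : (reflectionMatrix a b).det ≠ 0 := by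
    rw [reflectionMatrix, det_fin_two_of]
    intro h
    exact hab0 (by linear_combination -h)
  set X := GeneralLinearGroup.mkOfDetNeZero _ (hdX.trans_ne one_ne_zero) with hX
  set Y := GeneralLinearGroup.mkOfDetNeZero _ (hdY.trans_ne one_ne_zero) with hY
  set T := GeneralLinearGroup.mkOfDetNeZero _ hdT with hT
  have hXv : X.val = !![0, -1; 1, 0] := rfl
  have hYv : Y.val = tripleMatrix r a b := rfl
  have hTv : T.val = reflectionMatrix a b := rfl
  have htX : X.val.trace = 0 := by rw [hXv, trace_fin_two]; simp
  have htY : Y.val.trace = 1 := by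
    rw [hYv, tripleMatrix, trace_fin_two]; simp; field_simp; norm_num
  have htT : T.val.trace = 0 := by rw [hTv, reflectionMatrix, trace_fin_two]; simp
  have htYX : (Y * X).val.trace = r := by
    rw [Units.val_mul, hYv, hXv, tripleMatrix, trace_fin_two]
    simp [mul_apply]
    field_simp
    ring
  have hx2 := moebiusHom_sq_of_trace htX
  have hx1 := moebiusHom_ne_one_of_trace h2 htX
  have hy3 := moebiusHom_cube_of_trace hdY htY
  have ht2 := moebiusHom_sq_of_trace htT
  have ht1 := moebiusHom_ne_one_of_trace h2 htT
  have hdYX : (Y * X).val.det = 1 := by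
    rw [Units.val_mul, Matrix.det_mul, hXv, hYv, hdX, hdY, one_mul]
  obtain ⟨P, ζ, hP, hE, hζ⟩ := exists_isEigenpoint_of_trace hp hL hn hdYX hw (by rw [htYX, hr])
  have hc : IsSemiregularOfOrder (moebiusHom (ZMod p) (Y * X)) n :=
    hE.isSemiregular hn hdYX hP (by rw [hζ]; exact hw)
  have hcard : Nat.card (OnePoint (ZMod p)) = 2 * n := by rw [OnePoint.card_zmod, hn]
  -- T anticommutes with X and satisfies YTY = T, so t commutes with the involution x and inverts y.
  have hTX : moebiusHom (ZMod p) T * moebiusHom (ZMod p) X =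
      moebiusHom (ZMod p) X * moebiusHom (ZMod p) T := by
    rw [← map_mul, ← map_mul, moebiusHom_eq_iff]
    refine ⟨-1, ?_⟩
    rw [Units.val_mul, Units.val_mul, hXv, hTv, reflectionMatrix]
    ext i j
    fin_cases i <;> fin_cases j <;> simp [mul_apply]
  have hYTY : moebiusHom (ZMod p) Y * moebiusHom (ZMod p) T * moebiusHom (ZMod p) Y =
      moebiusHom (ZMod p) T := by
    rw [← map_mul, ← map_mul, moebiusHom_eq_iff]
    refine ⟨1, ?_⟩
    rw [one_smul, Units.val_mul, Units.val_mul, hYv, hTv, reflectionMatrix, tripleMatrix]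
    ext i j
    fin_cases i <;> fin_cases j <;> simp [mul_apply] <;> field_simp
    · linear_combination b * hab
    · linear_combination -a * hab
    · linear_combination -a * hab
    · linear_combination -b * hab
  set x := moebiusHom (ZMod p) X with hxdef
  set y := moebiusHom (ZMod p) Y with hydef
  set t := moebiusHom (ZMod p) T with htdef
  have hyx : moebiusHom (ZMod p) (Y * X) = y * x := map_mul _ _ _
  let J : Januarial 3 (OnePoint (ZMod p)) :=
    { finite := inferInstance
      x := x
      y := y
      x_sq := hx2
      y_pow := hy3
      transitive := transitive_of_isEigenpoint hP hx2 hx1 hy3 hE hc hn3 hn6 hn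
      two_faces := by
        rw [← hyx]
        have h := hc.card_quotient_mul
        rw [hcard] at h
        exact Nat.eq_of_mul_eq_mul_right (by omega) h
      face_size := fun s => by
        rw [← hyx, hcard, isSemiregularOfOrder_iff.1 hc] }
  have htinv : t⁻¹ = t := by rw [inv_eq_iff_mul_eq_one, ← sq, ht2]
  have hxinv : x⁻¹ = x := by rw [inv_eq_iff_mul_eq_one, ← sq, hx2]
  have hxt2 : (t * x) ^ 2 = 1 := by
    rw [(show Commute t x from hTX).mul_pow, ht2, hx2, one_mul]
  -- The original pair is (`t * x`, y): its associate by t has first generator t(tx) = x.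
  refine ⟨J, ⟨mem_moebiusPSL_iff.2 ⟨X, hdX, rfl⟩, mem_moebiusPSL_iff.2 ⟨Y, hdY, rfl⟩, t * x,
    ⟨T * X, map_mul _ _ _⟩, t, ⟨T, rfl⟩, hxt2, ?_⟩, X, Y, ⟨hdX, hdY, htX, htY, rfl, rfl⟩, ?_⟩
  · refine ⟨orderOf_eq_prime ht2 ht1, ?_, ?_, ?_⟩
    · rw [_root_.mul_inv_rev, hxinv, htinv, ← mul_assoc, ← sq, ht2, one_mul]
    · change t⁻¹ * y * t = y⁻¹
      rw [eq_inv_iff_mul_eq_one, mul_assoc, mul_assoc, ← mul_assoc y, hYTY, inv_mul_cancel]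
    · change x = t * (t * x)
      rw [← mul_assoc, ← sq, ht2, one_mul]
  · rw [htYX, map_pow, hr]

end Existence

/-- The involution t of an associate commutes with its first generator and inverts y, so following
an orientation-reversing bijection by t restores the orientation. -/
theorem isoOrMirrorSetoid_eq_isoSetoid (p : ℕ) [Fact p.Prime] :
    Januarial.isoOrMirrorSetoid (associateJanuarials p) =
      Januarial.isoSetoid (associateJanuarials p) := by
  ext ⟨J, hJ⟩ ⟨J', hJ'⟩
  change J.IsoOrMirror J' ↔ J.Iso J'
  constructor
  · rintro ⟨e, hx, hy | hy⟩
    · exact ⟨e, hx, hy⟩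
    · obtain ⟨-, -, x, -, t, -, hx2, ht⟩ := hJ'
      have ht2 : t ^ 2 = 1 := by rw [← ht.order_t, pow_orderOf_eq_one]
      have htinv : t⁻¹ = t := by rw [inv_eq_iff_mul_eq_one, ← sq, ht2]
      have hxinv : x⁻¹ = x := by rw [inv_eq_iff_mul_eq_one, ← sq, hx2]
      have h1 := ht.conj_x
      have h2 := ht.conj_y
      rw [hxinv, htinv] at h1
      have h3 : t * J'.x = J'.x * t := by rw [ht.eq, h1, ← mul_assoc, ← sq, ht2, one_mul]
      have h4 : t * J'.y⁻¹ = J'.y * t := by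
        rw [← h2]; group
      refine ⟨e.trans t, fun s => ?_, fun s => ?_⟩
      · rw [Equiv.trans_apply, Equiv.trans_apply, hx]
        exact congrArg (fun f => f (e s)) h3
      · rw [Equiv.trans_apply, Equiv.trans_apply, hy]
        exact congrArg (fun f => f (e s)) h4
  · rintro ⟨e, hx, hy⟩
    exact ⟨e, hx, Or.inl hy⟩

/-! ### Classes correspond to squared traces -/

section Counting

variable {p : ℕ} [Fact p.Prime] {L : Type*} [Field L] [Algebra (ZMod p) L] [Fintype L]
  [DecidableEq L] {n : ℕ}

theorem card_isoSetoid_quotient (hp : 3 < p) (hL : Fintype.card L = p ^ 2)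
    (hn : 2 * n = p + 1) (hn3 : 3 ≤ n) (hn6 : n ≠ 6) :
    Nat.card (Quotient (Januarial.isoSetoid (associateJanuarials p))) = (sqTraces L n).card := by
  have hlift : ∀ J : associateJanuarials p, ∃ s : sqTraces L n, ∃ X Y, IsLift J.1 X Y ∧
      algebraMap (ZMod p) L ((Y * X).val.trace ^ 2) = s := by
    rintro ⟨J, hJ⟩
    obtain ⟨X, Y, h⟩ := exists_isLift hn hn3 hJ.1 hJ.2.1
    exact ⟨⟨_, h.trace_sq_mem hp hL hn⟩, X, Y, h, rfl⟩
  choose f hf using hlift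
  have hiso : ∀ J J' : associateJanuarials p, J.1.Iso J'.1 → f J = f J' := by
    intro J J' hJJ
    by_cases hn7 : 7 ≤ n
    · obtain ⟨X, Y, h, hs⟩ := hf J
      obtain ⟨X', Y', h', hs'⟩ := hf J'
      exact Subtype.ext (by rw [← hs, ← hs', h.trace_sq_eq_of_iso (L := L) hp hL hn hn7 h' hJJ])
    -- Below 7 only n = 3 and n = 4 remain, as n = 5 would mean p = 9; then φ(n) = 2 and there is
    -- only one value.
    · obtain ⟨w, hw⟩ := exists_isPrimitiveRoot hL hn
      have h1 := two_mul_card_sqTraces hn3 hw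
      have h2 : n.totient = 2 := by
        have hn5 : n ≠ 5 := by
          rintro rfl
          obtain rfl : p = 9 := by omega
          exact absurd (Fact.out : (9 : ℕ).Prime) (by norm_num)
        obtain rfl | rfl : n = 3 ∨ n = 4 := by omega
        · rfl
        · rfl
      have h3 : (sqTraces L n).card ≤ 1 := by omega
      exact Subtype.ext (Finset.card_le_one.1 h3 _ (f J).2 _ (f J').2)
  let F : Quotient (Januarial.isoSetoid (associateJanuarials p)) → sqTraces L n :=
    Quotient.lift f hiso
  have hF : Function.Bijective F := by
    constructor
    · rintro ⟨J⟩ ⟨J'⟩ h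
      obtain ⟨X, Y, hl, hs⟩ := hf J
      obtain ⟨X', Y', hl', hs'⟩ := hf J'
      refine Quotient.sound (hl.iso_of_trace_sq_eq (L := L) hp hL hn hn3 hn6 hl' ?_)
      apply (algebraMap (ZMod p) L).injective
      rw [hs, hs']
      exact congrArg Subtype.val h
    · rintro ⟨s, hs⟩
      obtain ⟨J, hJ, X, Y, hl, ht⟩ := exists_associateJanuarial hp hL hn hn3 hn6 hs
      refine ⟨Quotient.mk _ ⟨J, hJ⟩, Subtype.ext ?_⟩
      obtain ⟨X', Y', hl', hs'⟩ := hf ⟨J, hJ⟩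
      change (f ⟨J, hJ⟩ : L) = s
      rw [← ht, ← hs', trace_sq_eq_of_moebiusHom_eq hl'.det_mul hl.det_mul]
      rw [map_mul, map_mul, hl.map_x, hl.map_y, hl'.map_x, hl'.map_y]
  rw [Nat.card_congr (Equiv.ofBijective F hF), Nat.card_eq_fintype_card, Fintype.card_coe]

end Counting

theorem mainTheorem3 (p : ℕ) [Fact p.Prime] (hp : 3 < p) (hp11 : p ≠ 11) :
    2 * Nat.card (Quotient (Januarial.isoSetoid (associateJanuarials p))) =
        Nat.totient ((p + 1) / 2) ∧
      2 * Nat.card (Quotient (Januarial.isoOrMirrorSetoid (associateJanuarials p))) =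
        Nat.totient ((p + 1) / 2) := by
  classical
  rw [isoOrMirrorSetoid_eq_isoSetoid, and_self]
  obtain ⟨m, hm⟩ := (Fact.out : p.Prime).odd_of_ne_two (by omega)
  have hn : 2 * ((p + 1) / 2) = p + 1 := by omega
  have := Fintype.ofFinite (GaloisField p 2)
  have hL : Fintype.card (GaloisField p 2) = p ^ 2 := by
    rw [← Nat.card_eq_fintype_card, GaloisField.card p 2 two_ne_zero]
  obtain ⟨w, hw⟩ := exists_isPrimitiveRoot hL hn
  rw [card_isoSetoid_quotient hp hL hn (by omega) (by omega),
    two_mul_card_sqTraces (by omega) hw]
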